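/- Let $n\in\mathbf N$, $1\le p<\infty$, $0\le s<1$ and $x_0\in\mathbf R^n$. Fix a window $\phi\in\mathcal S(\mathbf R^n)\setminus\{0\}$ and for $f\in\mathcal S'(\mathbf R^n)$ put $V_\phi f(x,\xi)=\langle f, M_\xi T_x\phi\rangle$, which for functions is $\int_{\mathbf R^n} f(t)\overline{\phi(t-x)}e^{-it\cdot\xi}\,dt$. Let $X=M^{p,1}_s(\mathbf R^n)$ be the space of all $f\in\mathcal S'(\mathbf R^n)$ with $$\|f\|_{M^{p,1}_s}=\int_{\mathbf R^n}(1+|\xi|^2)^{s/2}\Big(\int_{\mathbf R^n}|V_\phi f(x,\xi)|^p\,dx\Big)^{1/p}d\xi<\infty ,$$ whose elements are identified with continuous functions on $\mathbf R^n$. A closed ideal of $X$ is a norm-closed linear subspace $I\subseteq X$ with $fg\in I$ (pointwise product) for all $f\in X$, $g\in I$. For a closed set $E\subseteq\mathbf R^n$ let $I(E)=\{f\in X: f(x)=0 \text{ for all } x\in E\}$, and let $J(E)$ be the closed ideal generated by $J_0(E)=\{f\in X: f=0 \text{ in a neighbourhood of } E\}$, i.e. the intersection of all closed ideals of $X$ containing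 $J_0(E)$. The set $E$ is called a set of spectral synthesis for $X$ if $I(E)=J(E)$. **Theorem.** For every such $n,p,s,x_0$ and every window $\phi$, the singleton $\{x_0\}$ is a set of spectral synthesis for $M^{p,1}_s(\mathbf R^n)$, i.e. $I(\{x_0\})=J(\{x_0\})$. -/

import Mathlib

open MeasureTheory Topology
open scoped SchwartzMap ENNReal

noncomputable section

namespace ModulationSpace

/-- The character `t ↦ exp (-i t·ξ)` on `ℝⁿ`. -/
def character {n : ℕ} (ξ : EuclideanSpace ℝ (Fin n)) (t : EuclideanSpace ℝ (Fin n)) : ℂ :=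
  Complex.exp (-(Complex.I * (inner ℝ t ξ : ℝ)))

/-- The function `y ↦ exp (-i y)` on `ℝ` has temperate growth. -/
theorem hasTemperateGrowth_exp_neg_I :
    Function.HasTemperateGrowth (fun y : ℝ => Complex.exp (-(Complex.I * y))) := by
  have hd : ∀ y : ℝ, HasDerivAt (fun y : ℝ => Complex.exp (-(Complex.I * y)))
      (-Complex.I * Complex.exp (-(Complex.I * y))) y := by
    intro y
    have h1 : HasDerivAt (fun y : ℝ => -(Complex.I * (y : ℂ))) (-(Complex.I * 1)) y :=
      ((Complex.ofRealCLM.hasDerivAt (x := y)).const_mul Complex.I).neg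
    simpa [mul_comm] using h1.cexp
  have hn : ∀ m : ℕ, iteratedDeriv m (fun y : ℝ => Complex.exp (-(Complex.I * y))) =
      fun y : ℝ => (-Complex.I) ^ m * Complex.exp (-(Complex.I * y)) := by
    intro m
    induction m with
    | zero => ext y; simp
    | succ m ih =>
      rw [iteratedDeriv_succ, ih]
      ext y
      rw [((hd y).const_mul _).deriv]
      ring
  refine ⟨((Complex.ofRealCLM.contDiff.const_smul Complex.I).neg).cexp, fun m => ⟨0, 1, fun y => ?_⟩⟩
  rw [norm_iteratedFDeriv_eq_norm_iteratedDeriv, hn]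
  simp [Complex.norm_exp]

/-- The characters have temperate growth, so that multiplication by them acts on `𝓢`. -/
theorem hasTemperateGrowth_character {n : ℕ} (ξ : EuclideanSpace ℝ (Fin n)) :
    Function.HasTemperateGrowth (character ξ) :=
  hasTemperateGrowth_exp_neg_I.comp (Function.hasTemperateGrowth_inner_left ξ)

/-- The Schwartz function `t ↦ conj (M_ξ T_x φ (t)) = exp (-i t·ξ) * conj (φ (t - x))`. -/
def timeFrequencyShiftConj {n : ℕ} (φ : 𝓢(EuclideanSpace ℝ (Fin n), ℂ))
    (x ξ : EuclideanSpace ℝ (Fin n)) : 𝓢(EuclideanSpace ℝ (Fin n), ℂ) :=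
  SchwartzMap.smulLeftCLM ℂ (character ξ)
    (SchwartzMap.postcompCLM (𝕜 := ℝ) Complex.conjCLE.toContinuousLinearMap
      (SchwartzMap.compSubConstCLM ℂ x φ))

theorem timeFrequencyShiftConj_apply {n : ℕ} (φ : 𝓢(EuclideanSpace ℝ (Fin n), ℂ))
    (x ξ t : EuclideanSpace ℝ (Fin n)) :
    timeFrequencyShiftConj φ x ξ t =
      Complex.exp (-(Complex.I * (inner ℝ t ξ : ℝ))) * starRingEnd ℂ (φ (t - x)) := by
  simp [timeFrequencyShiftConj,
    SchwartzMap.smulLeftCLM_apply_apply (hasTemperateGrowth_character ξ), character]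

/-- The short-time Fourier transform `V_φ f (x, ξ) = ⟨f, M_ξ T_x φ⟩` (pairing antilinear in the
second slot) of a tempered distribution `f` with respect to the window `φ`. -/
def stft {n : ℕ} (φ : 𝓢(EuclideanSpace ℝ (Fin n), ℂ)) (f : 𝓢'(EuclideanSpace ℝ (Fin n), ℂ))
    (x ξ : EuclideanSpace ℝ (Fin n)) : ℂ :=
  f (timeFrequencyShiftConj φ x ξ)

/-- The (extended) norm of `M^{p,q}_s(ℝⁿ)` with window `φ`: the `L^q` norm in `ξ` of
`⟨ξ⟩^s * ‖V_φ f (·, ξ)‖_{L^p}`, where `⟨ξ⟩ = (1 + |ξ|²)^{1/2}`. -/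
def modulationNorm {n : ℕ} (φ : 𝓢(EuclideanSpace ℝ (Fin n), ℂ)) (p q : ℝ≥0∞) (s : ℝ)
    (f : 𝓢'(EuclideanSpace ℝ (Fin n), ℂ)) : ℝ≥0∞ :=
  eLpNorm (fun ξ : EuclideanSpace ℝ (Fin n) =>
    ENNReal.ofReal ((1 + ‖ξ‖ ^ 2) ^ (s / 2)) *
      eLpNorm (fun x : EuclideanSpace ℝ (Fin n) => stft φ f x ξ) p volume) q volume

/-- The modulation space `M^{p,q}_s(ℝⁿ)` (with window `φ`), a set of tempered distributions. -/
def modulationSpace {n : ℕ} (φ : 𝓢(EuclideanSpace ℝ (Fin n), ℂ)) (p q : ℝ≥0∞) (s : ℝ) :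
    Set (𝓢'(EuclideanSpace ℝ (Fin n), ℂ)) :=
  {f | modulationNorm φ p q s f < ∞}

/-- The tempered distribution `f` is (integration against) the continuous function `u`. -/
def IsContinuousRep {n : ℕ} (f : 𝓢'(EuclideanSpace ℝ (Fin n), ℂ))
    (u : EuclideanSpace ℝ (Fin n) → ℂ) : Prop :=
  Continuous u ∧ ∀ g : 𝓢(EuclideanSpace ℝ (Fin n), ℂ),
    Integrable (fun t => g t * u t) volume ∧ f g = ∫ t, g t * u t

/-- `h` is the pointwise product of the tempered distributions `f` and `g`, all three being
continuous functions. -/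
def IsPointwiseProduct {n : ℕ} (f g h : 𝓢'(EuclideanSpace ℝ (Fin n), ℂ)) : Prop :=
  ∃ u v : EuclideanSpace ℝ (Fin n) → ℂ,
    IsContinuousRep f u ∧ IsContinuousRep g v ∧ IsContinuousRep h (u * v)

/-- `I` is a closed ideal of `X = M^{p,1}_s(ℝⁿ)`: a linear subspace of `X` such that `f g ∈ I`
whenever `f ∈ X` and `g ∈ I`, and which is closed in `X` for the norm of `X`. -/
structure IsClosedIdeal {n : ℕ} (φ : 𝓢(EuclideanSpace ℝ (Fin n), ℂ)) (p : ℝ≥0∞) (s : ℝ)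
    (I : Submodule ℂ (𝓢'(EuclideanSpace ℝ (Fin n), ℂ))) : Prop where
  subset : ∀ f ∈ I, f ∈ modulationSpace φ p 1 s
  mul_mem : ∀ f ∈ modulationSpace φ p 1 s, ∀ g ∈ I, ∃ h ∈ I, IsPointwiseProduct f g h
  closed : ∀ f ∈ modulationSpace φ p 1 s,
    (∀ ε : ℝ≥0∞, 0 < ε → ∃ g ∈ I, modulationNorm φ p 1 s (f - g) < ε) → f ∈ I

/-- `I(E)`: the elements of `M^{p,1}_s(ℝⁿ)` vanishing on `E`. -/
def vanishingOn {n : ℕ} (φ : 𝓢(EuclideanSpace ℝ (Fin n), ℂ)) (p : ℝ≥0∞) (s : ℝ)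
    (E : Set (EuclideanSpace ℝ (Fin n))) : Set (𝓢'(EuclideanSpace ℝ (Fin n), ℂ)) :=
  {f | f ∈ modulationSpace φ p 1 s ∧ ∃ u, IsContinuousRep f u ∧ ∀ x ∈ E, u x = 0}

/-- `J₀(E)`: the elements of `M^{p,1}_s(ℝⁿ)` vanishing in a neighbourhood of `E`. -/
def vanishingNear {n : ℕ} (φ : 𝓢(EuclideanSpace ℝ (Fin n), ℂ)) (p : ℝ≥0∞) (s : ℝ)
    (E : Set (EuclideanSpace ℝ (Fin n))) : Set (𝓢'(EuclideanSpace ℝ (Fin n), ℂ)) :=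
  {f | f ∈ modulationSpace φ p 1 s ∧ ∃ u, IsContinuousRep f u ∧ ∀ᶠ x in 𝓝ˢ E, u x = 0}

/-- The closed ideal of `M^{p,1}_s(ℝⁿ)` generated by `S`: the intersection of all closed ideals
containing `S`. -/
def closedIdealGenerated {n : ℕ} (φ : 𝓢(EuclideanSpace ℝ (Fin n), ℂ)) (p : ℝ≥0∞) (s : ℝ)
    (S : Set (𝓢'(EuclideanSpace ℝ (Fin n), ℂ))) : Set (𝓢'(EuclideanSpace ℝ (Fin n), ℂ)) :=
  {f | f ∈ modulationSpace φ p 1 s ∧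
    ∀ I : Submodule ℂ (𝓢'(EuclideanSpace ℝ (Fin n), ℂ)),
      IsClosedIdeal φ p s I → S ⊆ (I : Set (𝓢'(EuclideanSpace ℝ (Fin n), ℂ))) → f ∈ I}

/-- `E` is a set of spectral synthesis for `M^{p,1}_s(ℝⁿ)`: it is closed, and `I(E)` is the closed
ideal `J(E)` generated by `J₀(E)`. -/
def IsSpectralSynthesisSet {n : ℕ} (φ : 𝓢(EuclideanSpace ℝ (Fin n), ℂ)) (p : ℝ≥0∞) (s : ℝ)
    (E : Set (EuclideanSpace ℝ (Fin n))) : Prop :=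
  IsClosed E ∧ vanishingOn φ p s E = closedIdealGenerated φ p s (vanishingNear φ p s E)

end ModulationSpace

end

/-! One inclusion is formal. Elements of the space are bounded continuous functions with sup norm
controlled by the norm, and they form an algebra under pointwise multiplication. So
`vanishingSubmodule` is a closed ideal, and it contains `vanishingNear`.

For the other inclusion it suffices to approximate any u with u(x₀) = 0 by functions vanishing near
x₀. Take a bump χ equal to 1 near 0 and put χ_k(t) = χ(k(t - x₀)). Then u - uχ_k vanishes near x₀,
and the point is that uχ_k tends to 0 in norm. Let θ be a cutoff equal to 1 on the supports of all
χ_k with k ≥ 1, let a = θu and let A be its Fourier transform, which is integrable against the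
weight w. Since a(x₀) = ∫ e(⟨x₀,η⟩) A(η) dη = 0, a multiple of the transform of χ_k can be
subtracted inside the convolution: (aχ_k)^(ξ) = ∫ A(η) [χ_k^(ξ - η) - e(⟨x₀,η⟩) χ_k^(ξ)] dη. After
rescaling, its weighted L¹ norm is at most ∫ |A(η)| ω_k(η) dη, where ω_k is `dilationModulus`
(`lintegral_weight_fourier_mul_le`). For fixed η, ω_k(η) = O(k^(s-1)|η|), which tends to 0 because s
< 1; moreover ω_k ≤ C w uniformly in k. Dominated convergence gives the limit 0
(`tendsto_lintegral_mul_dilationModulus`). Finally uχ_k = (aχ_k)θ, and multiplying the fixed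
Schwartz function θ by a weighted Fourier-L¹ function costs only the norm of the latter
(`stftNorm_schwartz_mul_le`).

The analytic basis is the reproducing formula `integral_tfKernel_mul`. It gives the change of window
together with a bound uniform in position (`exists_mixedNorm_tfShift_le`), the continuous
representative (`exists_represents`) and, through the window h², the algebra property
(`stftNorm_mul_lt_top`). All of this uses the 2π-normalised Fourier transform;
`exists_modulationNorm_eq` compares it with the normalisation of the definitions. -/

namespace ModulationSpace
open scoped FourierTransform

set_option linter.unusedSectionVars false

/-! ### Schwartz seminorms under translation. -/

section Schwartz

variable {E : Type*} [NormedAddCommGroup E] [NormedSpace ℝ E]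

/-- The supremum of the Schwartz seminorms with indices up to `m`. -/
noncomputable def schwartzSup (m : ℕ × ℕ) : Seminorm ℂ 𝓢(E, ℂ) :=
  (Finset.Iic m).sup (schwartzSeminormFamily ℂ E ℂ)

theorem continuous_schwartzSup (m : ℕ × ℕ) : Continuous (schwartzSup (E := E) m) := by
  have := Seminorm.continuous_finsetSup (s := Finset.Iic m) (p := schwartzSeminormFamily ℂ E ℂ)
    (fun i _ => (schwartz_withSeminorms ℂ E ℂ).continuous_seminorm i)
  exact this

theorem one_add_norm_pow_mul_le_schwartzSup {m : ℕ × ℕ} {k l : ℕ} (hk : k ≤ m.1) (hl : l ≤ m.2)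
    (f : 𝓢(E, ℂ)) (x : E) :
    (1 + ‖x‖) ^ k * ‖iteratedFDeriv ℝ l f x‖ ≤ 2 ^ m.1 * schwartzSup m f :=
  SchwartzMap.one_add_le_sup_seminorm_apply (𝕜 := ℂ) hk hl f x

theorem norm_le_schwartzSup (k : ℕ) (f : 𝓢(E, ℂ)) (x : E) :
    (1 + ‖x‖) ^ k * ‖f x‖ ≤ 2 ^ k * schwartzSup (k, 0) f := by
  simpa using one_add_norm_pow_mul_le_schwartzSup (m := (k, 0)) le_rfl le_rfl f x

theorem schwartzSup_le_of_bound {m : ℕ × ℕ} {f : 𝓢(E, ℂ)} {C : ℝ} (hC : 0 ≤ C)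
    (h : ∀ k l, k ≤ m.1 → l ≤ m.2 → ∀ x, ‖x‖ ^ k * ‖iteratedFDeriv ℝ l f x‖ ≤ C) :
    schwartzSup m f ≤ C := by
  refine Seminorm.finset_sup_apply_le hC fun i hi => ?_
  obtain ⟨h1, h2⟩ := Prod.mk_le_mk.1 (Finset.mem_Iic.1 hi)
  exact SchwartzMap.seminorm_le_bound ℂ _ _ f hC (h _ _ h1 h2)

theorem exists_le_schwartzSup (q : Seminorm ℂ 𝓢(E, ℂ)) (hq : Continuous q) :
    ∃ (m : ℕ × ℕ) (C : ℝ), 0 ≤ C ∧ ∀ f, q f ≤ C * schwartzSup m f := by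
  obtain ⟨s, C, -, h⟩ := Seminorm.bound_of_continuous (schwartz_withSeminorms ℂ E ℂ) q hq
  refine ⟨(s.sup Prod.fst, s.sup Prod.snd), C, C.2, fun f => ?_⟩
  have hs : s ⊆ Finset.Iic (s.sup Prod.fst, s.sup Prod.snd) := fun i hi =>
    Finset.mem_Iic.2 ⟨Finset.le_sup (f := Prod.fst) hi, Finset.le_sup (f := Prod.snd) hi⟩
  have h1 : s.sup (schwartzSeminormFamily ℂ E ℂ) f ≤ schwartzSup (s.sup Prod.fst, s.sup Prod.snd) f :=
    Seminorm.le_def.1 (Finset.sup_mono hs) f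
  calc q f ≤ C * s.sup (schwartzSeminormFamily ℂ E ℂ) f := h f
    _ ≤ _ := mul_le_mul_of_nonneg_left h1 C.2

/-- Continuous linear maps on `𝓢` are bounded for the seminorms `schwartzSup`. -/
theorem exists_schwartzSup_map_le (T : 𝓢(E, ℂ) →L[ℂ] 𝓢(E, ℂ)) (m : ℕ × ℕ) :
    ∃ (m' : ℕ × ℕ) (C : ℝ), 0 ≤ C ∧ ∀ f, schwartzSup m (T f) ≤ C * schwartzSup m' f :=
  exists_le_schwartzSup ((schwartzSup m).comp T.toLinearMap)
    ((continuous_schwartzSup m).comp T.continuous)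

theorem exists_norm_le_schwartzSup (f : 𝓢(E, ℂ) →L[ℂ] ℂ) :
    ∃ (m : ℕ × ℕ) (C : ℝ), 0 ≤ C ∧ ∀ g, ‖f g‖ ≤ C * schwartzSup m g :=
  exists_le_schwartzSup ((normSeminorm ℂ ℂ).comp f.toLinearMap) (f.continuous.norm)

theorem tendsto_schwartz_of_schwartzSup {ι : Type*} {l : Filter ι} {u : ι → 𝓢(E, ℂ)} {g : 𝓢(E, ℂ)}
    (h : ∀ m, Filter.Tendsto (fun i => schwartzSup m (u i - g)) l (𝓝 0)) :
    Filter.Tendsto u l (𝓝 g) := by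
  rw [(schwartz_withSeminorms ℂ E ℂ).tendsto_nhds]
  intro m ε hε
  filter_upwards [(h m).eventually_lt_const hε] with i hi
  refine lt_of_le_of_lt ?_ hi
  exact Seminorm.le_def.1 (Finset.le_sup (f := schwartzSeminormFamily ℂ E ℂ)
    (Finset.mem_Iic.2 le_rfl)) _

omit [NormedSpace ℝ E] in
theorem one_add_norm_le_mul (x y : E) : 1 + ‖x‖ ≤ (1 + ‖x - y‖) * (1 + ‖y‖) := by
  have : ‖x‖ ≤ ‖x - y‖ + ‖y‖ := by simpa using norm_add_le (x - y) y
  nlinarith [norm_nonneg (x - y), norm_nonneg y]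

theorem schwartzSup_compSubConst_le (m : ℕ × ℕ) (x : E) (g : 𝓢(E, ℂ)) :
    schwartzSup m (SchwartzMap.compSubConstCLM ℂ x g) ≤
      2 ^ m.1 * (1 + ‖x‖) ^ m.1 * schwartzSup m g := by
  refine schwartzSup_le_of_bound (by positivity) fun k l hk hl t => ?_
  have h0 : ⇑(SchwartzMap.compSubConstCLM ℂ x g) = fun t => g (t - x) := rfl
  rw [h0, iteratedFDeriv_comp_sub]
  have h1 := one_add_norm_pow_mul_le_schwartzSup (le_refl m.1) hl g (t - x)
  calc ‖t‖ ^ k * ‖iteratedFDeriv ℝ l g (t - x)‖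
      ≤ ((1 + ‖t - x‖) * (1 + ‖x‖)) ^ m.1 * ‖iteratedFDeriv ℝ l g (t - x)‖ := by
        gcongr
        calc ‖t‖ ^ k ≤ (1 + ‖t‖) ^ k := by gcongr; linarith
          _ ≤ (1 + ‖t‖) ^ m.1 := pow_le_pow_right₀ (by linarith [norm_nonneg t]) hk
          _ ≤ _ := by gcongr; exact one_add_norm_le_mul t x
    _ = (1 + ‖x‖) ^ m.1 * ((1 + ‖t - x‖) ^ m.1 * ‖iteratedFDeriv ℝ l g (t - x)‖) := by
        rw [mul_pow]; ring
    _ ≤ (1 + ‖x‖) ^ m.1 * (2 ^ m.1 * schwartzSup m g) := by gcongr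
    _ = _ := by ring

/-- Mean value inequality, at the cost of one derivative. The factor linear in `‖x‖` later yields
the gain `k⁻¹ * ‖η‖` for dilated bumps. -/
theorem schwartzSup_compSubConst_sub_le (m : ℕ × ℕ) (x : E) (g : 𝓢(E, ℂ)) (hx : ‖x‖ ≤ 1) :
    schwartzSup m (SchwartzMap.compSubConstCLM ℂ x g - g) ≤
      4 ^ m.1 * schwartzSup (m.1, m.2 + 1) g * ‖x‖ := by
  refine schwartzSup_le_of_bound (by positivity) fun k l hk hl t => ?_
  have h0 : ⇑(SchwartzMap.compSubConstCLM ℂ x g - g) = (fun t => g (t - x)) - ⇑g := rfl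
  have h0' : ContDiff ℝ l fun t => g (t - x) := (g.smooth l).comp (contDiff_id.sub contDiff_const)
  rw [h0, iteratedFDeriv_sub_apply h0'.contDiffAt (g.smooth l).contDiffAt, iteratedFDeriv_comp_sub]
  have hd : ∀ z ∈ Metric.closedBall t 1, ‖fderiv ℝ (iteratedFDeriv ℝ l g) z‖ ≤
      (1 + ‖t‖) ^ (-(m.1 : ℤ)) * (4 ^ m.1 * schwartzSup (m.1, m.2 + 1) g) := by
    intro z hz
    rw [norm_fderiv_iteratedFDeriv]
    have h1 := one_add_norm_pow_mul_le_schwartzSup (m := (m.1, m.2 + 1)) (le_refl m.1)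
      (Nat.succ_le_succ hl) g z
    -- On the unit ball around `t` the weights at `t` and `z` differ by a factor at most 2; with the
    -- `2 ^ m.1` of the seminorm bound this makes `4 ^ m.1`.
    have h2 : (1 + ‖t‖) ≤ (1 + ‖z‖) * 2 := by
      have := one_add_norm_le_mul t (t - z)
      have h3 : ‖t - z‖ ≤ 1 := by simpa [dist_eq_norm, norm_sub_rev] using hz
      simp only [sub_sub_cancel] at this
      refine this.trans ?_
      gcongr
      linarith
    rw [zpow_neg, zpow_natCast, inv_mul_eq_div, le_div_iff₀ (by positivity)]
    calc ‖iteratedFDeriv ℝ (l + 1) g z‖ * (1 + ‖t‖) ^ m.1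
        ≤ ‖iteratedFDeriv ℝ (l + 1) g z‖ * ((1 + ‖z‖) * 2) ^ m.1 := by gcongr
      _ = 2 ^ m.1 * ((1 + ‖z‖) ^ m.1 * ‖iteratedFDeriv ℝ (l + 1) g z‖) := by rw [mul_pow]; ring
      _ ≤ 2 ^ m.1 * (2 ^ m.1 * schwartzSup (m.1, m.2 + 1) g) := by gcongr
      _ = _ := by rw [← mul_assoc, ← mul_pow]; norm_num
  have h1 := (convex_closedBall t 1).norm_image_sub_le_of_norm_fderiv_le (𝕜 := ℝ)
    (f := iteratedFDeriv ℝ l g) (x := t) (y := t - x)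
    (fun z _ => ((g.smooth (l + 1 : ℕ)).differentiable_iteratedFDeriv
      (by norm_cast; omega)).differentiableAt) hd (by simp) (by simpa [dist_eq_norm] using hx)
  calc ‖t‖ ^ k * ‖iteratedFDeriv ℝ l g (t - x) - iteratedFDeriv ℝ l g t‖
      ≤ (1 + ‖t‖) ^ m.1 * ‖iteratedFDeriv ℝ l g (t - x) - iteratedFDeriv ℝ l g t‖ := by
        gcongr
        calc ‖t‖ ^ k ≤ (1 + ‖t‖) ^ k := by gcongr; linarith
          _ ≤ (1 + ‖t‖) ^ m.1 := pow_le_pow_right₀ (by linarith [norm_nonneg t]) hk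
    _ ≤ (1 + ‖t‖) ^ m.1 * (((1 + ‖t‖) ^ (-(m.1 : ℤ)) *
          (4 ^ m.1 * schwartzSup (m.1, m.2 + 1) g)) * ‖t - x - t‖) := by gcongr
    _ = _ := by
        rw [zpow_neg, zpow_natCast]
        have : (1 + ‖t‖) ^ m.1 ≠ 0 := by positivity
        simp only [sub_sub_cancel_left, norm_neg]
        field_simp

/-- By the group law, continuity at 0 for every Schwartz function gives continuity everywhere. -/
theorem continuous_compSubConst (g : 𝓢(E, ℂ)) :
    Continuous fun x => SchwartzMap.compSubConstCLM ℂ x g := by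
  have h0 : ∀ g : 𝓢(E, ℂ), Filter.Tendsto (fun x => SchwartzMap.compSubConstCLM ℂ x g)
      (𝓝 0) (𝓝 g) := by
    intro g
    refine tendsto_schwartz_of_schwartzSup fun m => ?_
    have h1 : Filter.Tendsto (fun x : E => 4 ^ m.1 * schwartzSup (m.1, m.2 + 1) g * ‖x‖)
        (𝓝 0) (𝓝 0) := by
      have : Continuous (fun x : E => 4 ^ m.1 * schwartzSup (m.1, m.2 + 1) g * ‖x‖) := by fun_prop
      simpa using this.tendsto 0
    refine squeeze_zero' (Filter.Eventually.of_forall fun x => apply_nonneg _ _) ?_ h1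
    filter_upwards [Metric.closedBall_mem_nhds (0 : E) one_pos] with x hx
    exact schwartzSup_compSubConst_sub_le m x g (by simpa using hx)
  rw [continuous_iff_continuousAt]
  intro x
  have h1 := (h0 (SchwartzMap.compSubConstCLM ℂ x g)).comp
    (show Filter.Tendsto (fun y => y - x) (𝓝 x) (𝓝 0) by
      have : Continuous fun y : E => y - x := by fun_prop
      simpa using this.tendsto x)
  refine h1.congr fun y => ?_
  simp

end Schwartz

/-! ### Time-frequency shifts of Schwartz functions. -/

section TimeFrequency

variable {E : Type*} [NormedAddCommGroup E] [InnerProductSpace ℝ E] [FiniteDimensional ℝ E]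
  [MeasurableSpace E] [BorelSpace E]

/-- The time-frequency shift `g ↦ exp (-2πi ⟨·, ξ⟩) * g (· - x)` on Schwartz functions. -/
noncomputable def tfShift (x ξ : E) : 𝓢(E, ℂ) →L[ℂ] 𝓢(E, ℂ) :=
  (FourierTransform.fourierInvCLM ℂ 𝓢(E, ℂ)) ∘L (SchwartzMap.compSubConstCLM ℂ (-ξ)) ∘L
    (FourierTransform.fourierCLM ℂ 𝓢(E, ℂ)) ∘L (SchwartzMap.compSubConstCLM ℂ x)

/-- A translation conjugated by the Fourier transform is a modulation. In that form, seminorm bounds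
and continuity in both parameters come from those of translations, with no derivative of a character
to estimate. -/
theorem tfShift_apply (x ξ t : E) (g : 𝓢(E, ℂ)) :
    tfShift x ξ g t = (𝐞 (-inner ℝ t ξ) : ℂ) * g (t - x) := by
  set h := SchwartzMap.compSubConstCLM ℂ x g with hh
  have h1 : tfShift x ξ g t = 𝓕⁻ (SchwartzMap.compSubConstCLM ℂ (-ξ) (𝓕 h)) t := rfl
  have h2 : h t = 𝓕⁻ (𝓕 h) t := by simp
  have h3 : g (t - x) = h t := rfl
  rw [h1, h3, h2, SchwartzMap.fourierInv_coe, SchwartzMap.fourierInv_coe, Real.fourierInv_eq,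
    Real.fourierInv_eq, ← integral_const_mul]
  refine Eq.trans ?_ (integral_add_right_eq_self _ ξ)
  congr 1
  ext ζ
  simp only [SchwartzMap.compSubConstCLM_apply, sub_neg_eq_add, Circle.smul_def, inner_add_left,
    AddChar.map_add_eq_mul, Circle.coe_mul, smul_eq_mul]
  have h4 : (𝐞 (-inner ℝ t ξ) : ℂ) * 𝐞 (inner ℝ ξ t) = 1 := by
    rw [real_inner_comm, ← Circle.coe_mul, ← AddChar.map_add_eq_mul]
    simp
  linear_combination (-(𝐞 (inner ℝ ζ t) : ℂ) * 𝓕 h (ζ + ξ)) * h4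

theorem exists_schwartzSup_tfShift_le (m : ℕ × ℕ) : ∃ (K : ℕ) (m' : ℕ × ℕ) (C : ℝ), 0 ≤ C ∧
    ∀ (x ξ : E) (g : 𝓢(E, ℂ)), schwartzSup m (tfShift x ξ g) ≤
      C * ((1 + ‖x‖) ^ K * (1 + ‖ξ‖) ^ K) * schwartzSup m' g := by
  obtain ⟨m₁, C₁, hC₁, h₁⟩ := exists_schwartzSup_map_le
    (FourierTransform.fourierInvCLM ℂ 𝓢(E, ℂ)) m
  obtain ⟨m₂, C₂, hC₂, h₂⟩ := exists_schwartzSup_map_le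
    (FourierTransform.fourierCLM ℂ 𝓢(E, ℂ)) m₁
  refine ⟨max m₁.1 m₂.1, m₂, C₁ * 2 ^ m₁.1 * C₂ * 2 ^ m₂.1, by positivity, fun x ξ g => ?_⟩
  have hx : (1 + ‖x‖) ^ m₂.1 ≤ (1 + ‖x‖) ^ max m₁.1 m₂.1 :=
    pow_le_pow_right₀ (by linarith [norm_nonneg x]) (le_max_right _ _)
  have hξ : (1 + ‖ξ‖) ^ m₁.1 ≤ (1 + ‖ξ‖) ^ max m₁.1 m₂.1 :=
    pow_le_pow_right₀ (by linarith [norm_nonneg ξ]) (le_max_left _ _)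
  have h3 : 0 ≤ schwartzSup m₂ g := apply_nonneg _ _
  calc schwartzSup m (tfShift x ξ g)
      ≤ C₁ * schwartzSup m₁ (SchwartzMap.compSubConstCLM ℂ (-ξ)
        (FourierTransform.fourierCLM ℂ 𝓢(E, ℂ) (SchwartzMap.compSubConstCLM ℂ x g))) := h₁ _
    _ ≤ C₁ * (2 ^ m₁.1 * (1 + ‖-ξ‖) ^ m₁.1 * schwartzSup m₁
        (FourierTransform.fourierCLM ℂ 𝓢(E, ℂ) (SchwartzMap.compSubConstCLM ℂ x g))) := by
        gcongr; exact schwartzSup_compSubConst_le _ _ _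
    _ ≤ C₁ * (2 ^ m₁.1 * (1 + ‖-ξ‖) ^ m₁.1 *
        (C₂ * schwartzSup m₂ (SchwartzMap.compSubConstCLM ℂ x g))) := by
        gcongr; exact h₂ _
    _ ≤ C₁ * (2 ^ m₁.1 * (1 + ‖-ξ‖) ^ m₁.1 *
        (C₂ * (2 ^ m₂.1 * (1 + ‖x‖) ^ m₂.1 * schwartzSup m₂ g))) := by
        gcongr; exact schwartzSup_compSubConst_le _ _ _
    _ = C₁ * 2 ^ m₁.1 * C₂ * 2 ^ m₂.1 * ((1 + ‖x‖) ^ m₂.1 * (1 + ‖ξ‖) ^ m₁.1) *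
        schwartzSup m₂ g := by rw [norm_neg]; ring
    _ ≤ _ := by gcongr

/-- Separate continuity becomes joint continuity because the operators are bounded locally uniformly
in the parameters. -/
theorem continuous_tfShift (g : 𝓢(E, ℂ)) : Continuous fun z : E × E => tfShift z.1 z.2 g := by
  have hmod : ∀ h : 𝓢(E, ℂ), Continuous fun ξ : E => FourierTransform.fourierInvCLM ℂ 𝓢(E, ℂ)
      (SchwartzMap.compSubConstCLM ℂ (-ξ) (FourierTransform.fourierCLM ℂ 𝓢(E, ℂ) h)) := fun h =>
    (FourierTransform.fourierInvCLM ℂ 𝓢(E, ℂ)).continuous.comp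
      ((continuous_compSubConst _).comp continuous_neg)
  rw [continuous_iff_continuousAt]
  rintro ⟨x, ξ⟩
  refine tendsto_schwartz_of_schwartzSup fun m => ?_
  obtain ⟨K, m', C, hC, h⟩ := exists_schwartzSup_tfShift_le (E := E) m
  have h1 : ∀ z : E × E, tfShift z.1 z.2 g - tfShift x ξ g =
      tfShift 0 z.2 (SchwartzMap.compSubConstCLM ℂ z.1 g - SchwartzMap.compSubConstCLM ℂ x g) +
      (tfShift x z.2 g - tfShift x ξ g) := by
    intro z
    ext t
    simp [tfShift_apply]
  have h2 : Filter.Tendsto (fun z : E × E => C * ((1 + ‖(0 : E)‖) ^ K * (1 + ‖z.2‖) ^ K) *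
      schwartzSup m' (SchwartzMap.compSubConstCLM ℂ z.1 g - SchwartzMap.compSubConstCLM ℂ x g) +
      schwartzSup m (tfShift x z.2 g - tfShift x ξ g)) (𝓝 (x, ξ)) (𝓝 0) := by
    have hc1 : Continuous fun z : E × E => schwartzSup m'
        (SchwartzMap.compSubConstCLM ℂ z.1 g - SchwartzMap.compSubConstCLM ℂ x g) :=
      (continuous_schwartzSup m').comp
        (((continuous_compSubConst g).comp continuous_fst).sub continuous_const)
    have hc2 : Continuous fun z : E × E => schwartzSup m (tfShift x z.2 g - tfShift x ξ g) :=
      (continuous_schwartzSup m).comp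
        (((hmod (SchwartzMap.compSubConstCLM ℂ x g)).comp continuous_snd).sub continuous_const)
    have hc : Continuous fun z : E × E => C * ((1 + ‖(0 : E)‖) ^ K * (1 + ‖z.2‖) ^ K) *
      schwartzSup m' (SchwartzMap.compSubConstCLM ℂ z.1 g - SchwartzMap.compSubConstCLM ℂ x g) +
      schwartzSup m (tfShift x z.2 g - tfShift x ξ g) := by fun_prop
    simpa using hc.tendsto (x, ξ)
  refine squeeze_zero (fun z => apply_nonneg _ _) (fun z => ?_) h2
  rw [h1]
  exact (map_add_le_add _ _ _).trans (add_le_add_left (h _ _ _) _)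

theorem tfShift_tfShift (x ξ y η : E) (g : 𝓢(E, ℂ)) :
    tfShift x ξ (tfShift y η g) = (𝐞 (inner ℝ x η) : ℂ) • tfShift (x + y) (ξ + η) g := by
  ext t
  simp only [tfShift_apply, smul_apply, smul_eq_mul, sub_add_eq_sub_sub]
  rw [← mul_assoc, ← mul_assoc, ← Circle.coe_mul, ← Circle.coe_mul, ← AddChar.map_add_eq_mul,
    ← AddChar.map_add_eq_mul]
  congr 3
  simp only [inner_sub_left, inner_add_right]
  ring

end TimeFrequency

/-! ### Exchanging functionals on Schwartz space with integrals. -/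

/-- Hahn–Banach: the bound makes `f` vanish on the kernel of `ι`, so it descends to a bounded
functional on the range and extends. This moves an integral in Schwartz space to a Bochner integral
in a normed space. -/
theorem exists_continuousLinearMap_comp_eq {V Y : Type*} [AddCommGroup V] [Module ℂ V]
    [NormedAddCommGroup Y] [NormedSpace ℂ Y] (ι : V →ₗ[ℂ] Y) (f : V →ₗ[ℂ] ℂ) (C : ℝ)
    (h : ∀ g, ‖f g‖ ≤ C * ‖ι g‖) : ∃ L : Y →L[ℂ] ℂ, ∀ g, L (ι g) = f g := by
  -- The section `r` is merely linear; its choice is immaterial, since `f` kills the kernel of `ι`.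
  obtain ⟨r, hr⟩ := ι.rangeRestrict.exists_rightInverse_of_surjective
    (LinearMap.range_rangeRestrict ι)
  have hr' : ∀ y : LinearMap.range ι, ι (r y) = y := fun y =>
    congrArg Subtype.val (LinearMap.congr_fun hr y)
  let f' : LinearMap.range ι →L[ℂ] ℂ := (f ∘ₗ r).mkContinuous C fun y => by
    have := h (r y)
    rw [hr' y] at this
    exact this
  obtain ⟨L, hL, -⟩ := exists_extension_norm_eq (LinearMap.range ι) f'
  refine ⟨L, fun g => ?_⟩
  have h1 : L (ι g) = f (r (ι.rangeRestrict g)) := hL (ι.rangeRestrict g)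
  have h2 : ‖f (r (ι.rangeRestrict g) - g)‖ ≤ 0 := by
    refine (h _).trans ?_
    rw [map_sub, hr']
    simp
  rw [h1, ← sub_eq_zero, ← map_sub, ← norm_le_zero_iff]
  exact h2

section

variable {E : Type*} [NormedAddCommGroup E] [NormedSpace ℝ E]

/-- The space of continuous multilinear maps, with the instances coming from its norm. -/
def DerivSpace (E : Type*) [NormedAddCommGroup E] [NormedSpace ℝ E] (l : ℕ) : Type _ :=
  E [×l]→L[ℝ] ℂ

noncomputable instance (l : ℕ) : NormedAddCommGroup (DerivSpace E l) :=
  inferInstanceAs (NormedAddCommGroup (E [×l]→L[ℝ] ℂ))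

noncomputable instance (l : ℕ) : NormedSpace ℝ (DerivSpace E l) :=
  inferInstanceAs (NormedSpace ℝ (E [×l]→L[ℝ] ℂ))

noncomputable instance (l : ℕ) : NormedSpace ℂ (DerivSpace E l) :=
  inferInstanceAs (NormedSpace ℂ (E [×l]→L[ℝ] ℂ))

instance (l : ℕ) : SMulCommClass ℝ ℂ (DerivSpace E l) :=
  inferInstanceAs (SMulCommClass ℝ ℂ (E [×l]→L[ℝ] ℂ))

instance (l : ℕ) : CompleteSpace (DerivSpace E l) :=
  inferInstanceAs (CompleteSpace (E [×l]→L[ℝ] ℂ))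

/-- The iterated derivative as a function with values in `DerivSpace`. -/
noncomputable def iterDeriv (l : ℕ) (g : E → ℂ) : E → DerivSpace E l := iteratedFDeriv ℝ l g

/-- Currying of the first variable. -/
noncomputable def curryLeftEquiv (l : ℕ) : DerivSpace E (l + 1) ≃ₗᵢ[ℝ] (E →L[ℝ] DerivSpace E l) :=
  continuousMultilinearCurryLeftEquiv ℝ (fun _ : Fin (l + 1) => E) ℂ

theorem fderiv_iterDeriv (l : ℕ) (g : E → ℂ) (t : E) :
    fderiv ℝ (iterDeriv l g) t = curryLeftEquiv l (iterDeriv (l + 1) g t) :=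
  congrFun (fderiv_iteratedFDeriv (𝕜 := ℝ) (f := g) (n := l)) t

theorem iterDeriv_succ (l : ℕ) (g : E → ℂ) (t : E) :
    iterDeriv (l + 1) g t = (curryLeftEquiv l).symm (fderiv ℝ (iterDeriv l g) t) := by
  rw [fderiv_iterDeriv, LinearIsometryEquiv.symm_apply_apply]

theorem differentiable_iterDeriv (l : ℕ) (g : 𝓢(E, ℂ)) : Differentiable ℝ (iterDeriv l g) :=
  (g.smooth (l + 1 : ℕ)).differentiable_iteratedFDeriv (by norm_cast; omega)

theorem continuous_norm_pow_smul_iterDeriv (k l : ℕ) (g : 𝓢(E, ℂ)) :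
    Continuous fun t : E => ‖t‖ ^ k • iterDeriv l g t :=
  (continuous_norm.pow k).smul (differentiable_iterDeriv l g).continuous

theorem norm_iterDeriv_le (k l : ℕ) (g : 𝓢(E, ℂ)) (t : E) :
    ‖‖t‖ ^ k • iterDeriv l g t‖ ≤ SchwartzMap.seminorm ℂ k l g := by
  rw [norm_smul, norm_pow, norm_norm]
  exact SchwartzMap.le_seminorm ℂ k l g t

theorem iterDeriv_add (l : ℕ) (f g : 𝓢(E, ℂ)) (t : E) :
    iterDeriv l (f + g : 𝓢(E, ℂ)) t = iterDeriv l f t + iterDeriv l g t :=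
  iteratedFDeriv_add_apply (f.smooth l).contDiffAt (g.smooth l).contDiffAt

theorem iterDeriv_smul (l : ℕ) (c : ℂ) (f : 𝓢(E, ℂ)) (t : E) :
    iterDeriv l (c • f : 𝓢(E, ℂ)) t = c • iterDeriv l f t :=
  iteratedFDeriv_const_smul_apply (f.smooth l).contDiffAt

/-- The weighted derivative `t ↦ ‖t‖ ^ k • D ^ l g t` as a bounded continuous function. -/
noncomputable def weightedDeriv (k l : ℕ) :
    𝓢(E, ℂ) →L[ℂ] BoundedContinuousFunction E (DerivSpace E l) :=
  SchwartzMap.mkCLMtoNormedSpace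
    (fun g : 𝓢(E, ℂ) => BoundedContinuousFunction.ofNormedAddCommGroup
      (fun t : E => ‖t‖ ^ k • iterDeriv l g t) (continuous_norm_pow_smul_iterDeriv k l g)
      (SchwartzMap.seminorm ℂ k l g) (norm_iterDeriv_le k l g))
    (fun f g => by
      ext t : 1
      simp only [BoundedContinuousFunction.coe_ofNormedAddCommGroup,
        BoundedContinuousFunction.add_apply]
      rw [iterDeriv_add, smul_add])
    (fun c f => by
      ext t : 1
      simp only [BoundedContinuousFunction.coe_ofNormedAddCommGroup,
        BoundedContinuousFunction.coe_smul, RingHom.id_apply]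
      rw [iterDeriv_smul, smul_comm])
    ⟨{(k, l)}, 1, zero_le_one, fun g => by
      simpa using BoundedContinuousFunction.norm_ofNormedAddCommGroup_le _
        (apply_nonneg (SchwartzMap.seminorm ℂ k l) g) _⟩

theorem weightedDeriv_apply (k l : ℕ) (g : 𝓢(E, ℂ)) (t : E) :
    weightedDeriv k l g t = ‖t‖ ^ k • iterDeriv l g t := rfl

theorem norm_weightedDeriv_le (k l : ℕ) (g : 𝓢(E, ℂ)) :
    ‖weightedDeriv k l g‖ ≤ schwartzSup (k, l) g := by
  rw [BoundedContinuousFunction.norm_le (apply_nonneg _ _)]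
  intro t
  refine (norm_iterDeriv_le k l g t).trans ?_
  exact Seminorm.le_def.1 (Finset.le_sup (f := schwartzSeminormFamily ℂ E ℂ)
    (Finset.mem_Iic.2 (le_refl (k, l)))) _

theorem schwartzSup_le_pi_norm (m : ℕ × ℕ) (g : 𝓢(E, ℂ)) :
    schwartzSup m g ≤ ‖fun i : Finset.Iic m => weightedDeriv i.1.1 i.1.2 g‖ := by
  refine schwartzSup_le_of_bound (norm_nonneg _) fun k l hk hl t => ?_
  have h1 := norm_le_pi_norm (fun i : Finset.Iic m => weightedDeriv i.1.1 i.1.2 g)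
    ⟨(k, l), Finset.mem_Iic.2 ⟨hk, hl⟩⟩
  refine le_trans ?_ h1
  have h2 := (weightedDeriv k l g).norm_coe_le_norm t
  rwa [weightedDeriv_apply, norm_smul, norm_pow, norm_norm] at h2

variable {Y : Type*} [MeasurableSpace Y] [TopologicalSpace Y] [OpensMeasurableSpace Y]
  [SecondCountableTopology Y] {μ : Measure Y} {G : Y → 𝓢(E, ℂ)}

theorem integrable_weightedDeriv (hG : Continuous G)
    (hint : ∀ m, Integrable (fun y => schwartzSup m (G y)) μ) (k l : ℕ) :
    Integrable (fun y => weightedDeriv k l (G y)) μ :=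
  (hint (k, l)).mono' ((weightedDeriv k l).continuous.comp hG).aestronglyMeasurable
    (Filter.Eventually.of_forall fun y => norm_weightedDeriv_le k l (G y))

theorem integrable_iterDeriv (hG : Continuous G)
    (hint : ∀ m, Integrable (fun y => schwartzSup m (G y)) μ) (l : ℕ) (t : E) :
    Integrable (fun y => iterDeriv l (G y) t) μ := by
  have := (BoundedContinuousFunction.evalCLM ℝ t).integrable_comp
    (integrable_weightedDeriv hG hint 0 l)
  simpa [weightedDeriv_apply] using this

/-- Differentiation under the integral sign, one order at a time, with the seminorm of index `(0, l
+ 1)` as dominating function. -/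
theorem iterDeriv_integral (hG : Continuous G)
    (hint : ∀ m, Integrable (fun y => schwartzSup m (G y)) μ) (l : ℕ) :
    iterDeriv l (fun t : E => ∫ y, G y t ∂μ) = fun t => ∫ y, iterDeriv l (G y) t ∂μ := by
  induction l with
  | zero =>
    have h := fun (g : E → ℂ) (t : E) =>
      congrFun (iteratedFDeriv_zero_eq_comp (𝕜 := ℝ) (f := g)) t
    let J : ℂ ≃ₗᵢ[ℝ] DerivSpace E 0 := (continuousMultilinearCurryFin0 ℝ E ℂ).symm
    have h' : ∀ (g : E → ℂ) (t : E), iterDeriv 0 g t = J (g t) := h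
    ext1 t
    simp only [h']
    exact (J.toContinuousLinearEquiv.integral_comp_comm (μ := μ) fun y => G y t).symm
  | succ l ih =>
    have h1 : ∀ t : E, HasFDerivAt (fun t : E => ∫ y, iterDeriv l (G y) t ∂μ)
        (∫ y, fderiv ℝ (iterDeriv l (G y)) t ∂μ) t := by
      intro t
      refine hasFDerivAt_integral_of_dominated_of_fderiv_le (𝕜 := ℝ) (s := Set.univ)
        (F := fun (t : E) y => iterDeriv l (G y) t)
        (F' := fun (t : E) y => fderiv ℝ (iterDeriv l (G y)) t)
        (bound := fun y => schwartzSup (0, l + 1) (G y)) Filter.univ_mem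
        (Filter.Eventually.of_forall fun t =>
          (integrable_iterDeriv hG hint l t).aestronglyMeasurable)
        (integrable_iterDeriv hG hint l t) ?_ ?_ (hint _) ?_
      · simp only [fderiv_iterDeriv]
        exact (curryLeftEquiv l).continuous.comp_aestronglyMeasurable
          (integrable_iterDeriv hG hint (l + 1) t).aestronglyMeasurable
      · refine Filter.Eventually.of_forall fun y (t : E) _ => ?_
        rw [fderiv_iterDeriv, LinearIsometryEquiv.norm_map]
        have := (weightedDeriv 0 (l + 1) (G y)).norm_coe_le_norm t
        rw [weightedDeriv_apply, pow_zero, one_smul] at this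
        exact this.trans (norm_weightedDeriv_le _ _ _)
      · exact Filter.Eventually.of_forall fun y t _ =>
          (differentiable_iterDeriv l (G y)).differentiableAt.hasFDerivAt
    ext1 t
    rw [iterDeriv_succ, ih, (h1 t).fderiv]
    simp only [fderiv_iterDeriv]
    have h2 := (curryLeftEquiv (E := E) l).toContinuousLinearEquiv.integral_comp_comm (μ := μ)
      (fun y => iterDeriv (l + 1) (G y) t)
    exact (congrArg (curryLeftEquiv l).symm h2).trans (LinearIsometryEquiv.symm_apply_apply _ _)

/-- Continuous functionals on `𝓢` commute with absolutely convergent integrals. -/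
theorem map_eq_integral_map (f : 𝓢(E, ℂ) →L[ℂ] ℂ) (hG : Continuous G)
    (hint : ∀ m, Integrable (fun y => schwartzSup m (G y)) μ) (h : 𝓢(E, ℂ))
    (hh : ∀ t, h t = ∫ y, G y t ∂μ) : f h = ∫ y, f (G y) ∂μ := by
  obtain ⟨m, C, hC, hf⟩ := exists_norm_le_schwartzSup f
  -- Only the finitely many seminorms that control `f` are needed, so a finite product of spaces of
  -- bounded continuous functions can receive the integral.
  let ι : 𝓢(E, ℂ) →L[ℂ]
      ((i : Finset.Iic m) → BoundedContinuousFunction E (DerivSpace E i.1.2)) :=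
    ContinuousLinearMap.pi fun i => weightedDeriv i.1.1 i.1.2
  obtain ⟨L, hL⟩ := exists_continuousLinearMap_comp_eq ι.toLinearMap f.toLinearMap C fun g =>
    (hf g).trans (mul_le_mul_of_nonneg_left (schwartzSup_le_pi_norm m g) hC)
  have hι : Integrable (fun y => ι (G y)) μ :=
    Integrable.of_eval fun i => integrable_weightedDeriv hG hint _ _
  have h1 : ι h = ∫ y, ι (G y) ∂μ := by
    ext1 i
    have h2 : (∫ y, ι (G y) ∂μ) i = ∫ y, ι (G y) i ∂μ :=
      eval_integral (fun i => integrable_weightedDeriv hG hint _ _) i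
    rw [h2]
    ext1 t
    have h3 := (BoundedContinuousFunction.evalCLM ℝ t).integral_comp_comm
      (integrable_weightedDeriv hG hint i.1.1 i.1.2)
    refine Eq.trans ?_ h3
    have h4 : ⇑h = fun t => ∫ y, G y t ∂μ := funext hh
    change ‖t‖ ^ i.1.1 • iterDeriv i.1.2 h t =
      ∫ y, ‖t‖ ^ i.1.1 • iterDeriv i.1.2 (G y) t ∂μ
    rw [h4, iterDeriv_integral hG hint, integral_smul]
  have h5 : ∀ g, f g = L (ι g) := fun g => (hL g).symm
  simp_rw [h5]
  rw [h1, L.integral_comp_comm hι]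

end

/-! ### Products of a Schwartz function with a distant translate. -/

section

variable {E : Type*} [NormedAddCommGroup E] [NormedSpace ℝ E]

/-- The pointwise product of Schwartz functions. -/
noncomputable def schwartzMul (f : 𝓢(E, ℂ)) : 𝓢(E, ℂ) →L[ℂ] 𝓢(E, ℂ) :=
  SchwartzMap.pairing (ContinuousLinearMap.mul ℂ ℂ) f

@[simp]
theorem schwartzMul_apply (f g : 𝓢(E, ℂ)) (t : E) : schwartzMul f g t = f t * g t := rfl

/-- Since `1 + ‖z‖ ≤ (1 + ‖t - z‖) * (1 + ‖t‖)`, any power of `1 + ‖z‖` is absorbed by the decay of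
the two factors, derivatives included via the Leibniz rule. -/
theorem exists_schwartzSup_mul_compSubConst_le (f g : 𝓢(E, ℂ)) (N : ℕ) (m : ℕ × ℕ) :
    ∃ C : ℝ, 0 ≤ C ∧ ∀ z : E, (1 + ‖z‖) ^ N *
      schwartzSup m (schwartzMul f (SchwartzMap.compSubConstCLM ℂ z g)) ≤ C := by
  set A := 2 ^ (N + m.1) * schwartzSup (N + m.1, m.2) f
  set B := 2 ^ N * schwartzSup (N, m.2) g
  have hA : 0 ≤ A := by positivity
  have hB : 0 ≤ B := by positivity
  refine ⟨2 ^ m.2 * (A * B), by positivity, fun z => ?_⟩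
  have hz : 0 < (1 + ‖z‖) ^ N := by positivity
  rw [mul_comm, ← le_div_iff₀ hz]
  refine schwartzSup_le_of_bound (by positivity) fun k l hk hl t => ?_
  rw [le_div_iff₀ hz]
  have h0 : ⇑(schwartzMul f (SchwartzMap.compSubConstCLM ℂ z g)) = fun t => f t * g (t - z) := rfl
  have h0' : ContDiff ℝ l fun t => g (t - z) := (g.smooth l).comp (contDiff_id.sub contDiff_const)
  have h1 := norm_iteratedFDeriv_mul_le (𝕜 := ℝ) (f.smooth l) h0' t le_rfl
  simp only [iteratedFDeriv_comp_sub] at h1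
  have h2 : ∀ i ∈ Finset.range (l + 1), ‖t‖ ^ k * (1 + ‖z‖) ^ N *
      ((l.choose i : ℝ) * ‖iteratedFDeriv ℝ i f t‖ * ‖iteratedFDeriv ℝ (l - i) g (t - z)‖) ≤
      l.choose i * (A * B) := by
    intro i hi
    have hi' : i ≤ l := Nat.lt_succ_iff.1 (Finset.mem_range.1 hi)
    have e1 := one_add_norm_pow_mul_le_schwartzSup (m := (N + m.1, m.2)) (le_refl (N + m.1))
      (hi'.trans hl) f t
    have e2 := one_add_norm_pow_mul_le_schwartzSup (m := (N, m.2)) (le_refl N)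
      ((Nat.sub_le l i).trans hl) g (t - z)
    calc ‖t‖ ^ k * (1 + ‖z‖) ^ N *
        ((l.choose i : ℝ) * ‖iteratedFDeriv ℝ i f t‖ * ‖iteratedFDeriv ℝ (l - i) g (t - z)‖)
        ≤ (1 + ‖t‖) ^ m.1 * ((1 + ‖t - z‖) * (1 + ‖t‖)) ^ N *
        ((l.choose i : ℝ) * ‖iteratedFDeriv ℝ i f t‖ * ‖iteratedFDeriv ℝ (l - i) g (t - z)‖) := by
          gcongr
          · calc ‖t‖ ^ k ≤ (1 + ‖t‖) ^ k := by gcongr; linarith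
              _ ≤ (1 + ‖t‖) ^ m.1 := pow_le_pow_right₀ (by linarith [norm_nonneg t]) hk
          · rw [norm_sub_rev]; exact one_add_norm_le_mul z t
      _ = l.choose i * (((1 + ‖t‖) ^ (N + m.1) * ‖iteratedFDeriv ℝ i f t‖) *
          ((1 + ‖t - z‖) ^ N * ‖iteratedFDeriv ℝ (l - i) g (t - z)‖)) := by rw [mul_pow]; ring
      _ ≤ l.choose i * (A * B) := by gcongr
  rw [h0]
  calc ‖t‖ ^ k * ‖iteratedFDeriv ℝ l (fun t => f t * g (t - z)) t‖ * (1 + ‖z‖) ^ N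
      = ‖t‖ ^ k * (1 + ‖z‖) ^ N * ‖iteratedFDeriv ℝ l (fun t => f t * g (t - z)) t‖ := by ring
    _ ≤ ‖t‖ ^ k * (1 + ‖z‖) ^ N * ∑ i ∈ Finset.range (l + 1),
        (l.choose i : ℝ) * ‖iteratedFDeriv ℝ i f t‖ * ‖iteratedFDeriv ℝ (l - i) g (t - z)‖ := by
        gcongr
    _ ≤ ∑ i ∈ Finset.range (l + 1), (l.choose i : ℝ) * (A * B) := by
        rw [Finset.mul_sum]; exact Finset.sum_le_sum h2
    _ = 2 ^ l * (A * B) := by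
        rw [← Finset.sum_mul, ← Nat.cast_sum, Nat.sum_range_choose]; norm_num
    _ ≤ 2 ^ m.2 * (A * B) := by gcongr; norm_num

end

/-! ### The reproducing formula and the change of window. -/

section

variable {E : Type*} [NormedAddCommGroup E] [InnerProductSpace ℝ E] [FiniteDimensional ℝ E]
  [MeasurableSpace E] [BorelSpace E]

/-- The kernel `(y, η) ↦ 𝓕⁻ (f * g (· - y)) (η)`. -/
noncomputable def tfKernel (f g : 𝓢(E, ℂ)) (y η : E) : ℂ :=
  (𝓕⁻ (schwartzMul f (SchwartzMap.compSubConstCLM ℂ y g)) : 𝓢(E, ℂ)) η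

/-- Decay in `y` comes from the small overlap of `f` with a distant translate of `g`; decay in `η`
comes from the Fourier transform. -/
theorem exists_norm_tfKernel_le (f g : 𝓢(E, ℂ)) (N : ℕ) : ∃ C : ℝ, 0 ≤ C ∧
    ∀ y η : E, (1 + ‖y‖) ^ N * (1 + ‖η‖) ^ N * ‖tfKernel f g y η‖ ≤ C := by
  obtain ⟨m, C₁, hC₁, h₁⟩ := exists_schwartzSup_map_le
    (FourierTransform.fourierInvCLM ℂ 𝓢(E, ℂ)) (N, 0)
  obtain ⟨C₂, hC₂, h₂⟩ := exists_schwartzSup_mul_compSubConst_le f g N m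
  refine ⟨2 ^ N * (C₁ * C₂), by positivity, fun y η => ?_⟩
  calc (1 + ‖y‖) ^ N * (1 + ‖η‖) ^ N * ‖tfKernel f g y η‖
      = (1 + ‖y‖) ^ N * ((1 + ‖η‖) ^ N * ‖tfKernel f g y η‖) := by ring
    _ ≤ (1 + ‖y‖) ^ N * (2 ^ N * (C₁ * schwartzSup m
        (schwartzMul f (SchwartzMap.compSubConstCLM ℂ y g)))) := by
        refine mul_le_mul_of_nonneg_left ((norm_le_schwartzSup N _ η).trans ?_) (by positivity)
        exact mul_le_mul_of_nonneg_left (h₁ _) (by positivity)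
    _ = 2 ^ N * (C₁ * ((1 + ‖y‖) ^ N * schwartzSup m
        (schwartzMul f (SchwartzMap.compSubConstCLM ℂ y g)))) := by ring
    _ ≤ _ := by gcongr; exact h₂ y

theorem continuous_tfKernel (f g : 𝓢(E, ℂ)) :
    Continuous fun z : E × E => tfKernel f g z.1 z.2 := by
  have h1 : Continuous fun y : E => SchwartzMap.toBoundedContinuousFunctionCLM ℂ E ℂ
      (FourierTransform.fourierInvCLM ℂ 𝓢(E, ℂ)
        (schwartzMul f (SchwartzMap.compSubConstCLM ℂ y g))) :=
    (ContinuousLinearMap.continuous _).comp ((ContinuousLinearMap.continuous _).comp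
      ((ContinuousLinearMap.continuous _).comp (continuous_compSubConst g)))
  exact continuous_eval.comp ((h1.comp continuous_fst).prodMk continuous_snd)

theorem integrable_one_add_norm_pow_inv :
    Integrable fun x : E => ((1 + ‖x‖) ^ (Module.finrank ℝ E + 1))⁻¹ := by
  have := integrable_one_add_norm (E := E) (μ := volume) (r := (Module.finrank ℝ E + 1 : ℕ))
    (by norm_cast; omega)
  refine this.congr (Filter.Eventually.of_forall fun x => ?_)
  simp only
  rw [Real.rpow_neg (by positivity), Real.rpow_natCast]

theorem integrable_schwartzSup_tfKernel_smul (f g h : 𝓢(E, ℂ)) (m : ℕ × ℕ) :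
    Integrable fun z : E × E => schwartzSup m (tfKernel f g z.1 z.2 • tfShift z.1 z.2 h) := by
  obtain ⟨K, m', C, hC, hle⟩ := exists_schwartzSup_tfShift_le (E := E) m
  -- The order `K` cancels the polynomial growth of the shifts, and the remaining `finrank + 1`
  -- makes the majorant integrable in each variable.
  obtain ⟨C', hC', hle'⟩ := exists_norm_tfKernel_le f g (K + (Module.finrank ℝ E + 1))
  have h1 := ((integrable_one_add_norm_pow_inv (E := E)).mul_prod
    (integrable_one_add_norm_pow_inv (E := E))).const_mul (C * C' * schwartzSup m' h)
  refine h1.mono' ?_ (Filter.Eventually.of_forall fun z => ?_)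
  · exact ((continuous_schwartzSup m).comp
      ((continuous_tfKernel f g).smul (continuous_tfShift h))).aestronglyMeasurable
  · rw [Real.norm_of_nonneg (apply_nonneg _ _), map_smul_eq_mul]
    have e1 := hle z.1 z.2 h
    have e2 := hle' z.1 z.2
    set a := 1 + ‖z.1‖
    set b := 1 + ‖z.2‖
    have ha : 0 < a := by positivity
    have hb : 0 < b := by positivity
    set D := Module.finrank ℝ E + 1
    rw [← mul_inv, ← div_eq_mul_inv, le_div_iff₀ (by positivity)]
    calc ‖tfKernel f g z.1 z.2‖ * schwartzSup m (tfShift z.1 z.2 h) * (a ^ D * b ^ D)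
        ≤ ‖tfKernel f g z.1 z.2‖ * (C * (a ^ K * b ^ K) * schwartzSup m' h) * (a ^ D * b ^ D) := by
          gcongr
      _ = C * schwartzSup m' h * (a ^ (K + D) * b ^ (K + D) * ‖tfKernel f g z.1 z.2‖) := by ring
      _ ≤ C * schwartzSup m' h * C' := by gcongr
      _ = _ := by ring

/-- The reproducing formula for the short-time Fourier transform, in weak form. -/
theorem integral_tfKernel_mul (L : 𝓢(E, ℂ) →L[ℂ] ℂ) (f g h : 𝓢(E, ℂ)) :
    (∫ t, g t * h t) * L f = ∫ z : E × E, tfKernel f g z.1 z.2 * L (tfShift z.1 z.2 h) := by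
  have hG : Continuous fun z : E × E => tfKernel f g z.1 z.2 • tfShift z.1 z.2 h :=
    (continuous_tfKernel f g).smul (continuous_tfShift h)
  have hint := integrable_schwartzSup_tfKernel_smul f g h
  have key := map_eq_integral_map (μ := (volume : Measure (E × E))) L hG hint
    ((∫ t, g t * h t) • f) ?_
  · simpa using key
  · intro t
    have hi : Integrable fun z : E × E => (tfKernel f g z.1 z.2 • tfShift z.1 z.2 h) t := by
      refine (hint (0, 0)).mono' ?_ (Filter.Eventually.of_forall fun z => ?_)
      · have : Continuous fun φ : 𝓢(E, ℂ) => φ t :=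
          (SchwartzMap.toBoundedContinuousFunctionCLM ℂ E ℂ).continuous.eval_const t
        exact (this.comp hG).aestronglyMeasurable
      · simpa using norm_le_schwartzSup 0 (tfKernel f g z.1 z.2 • tfShift z.1 z.2 h) t
    rw [Measure.volume_eq_prod, integral_prod _ hi]
    -- Integrating over `η` first is Fourier inversion; the remaining integral over `y` only
    -- produces the constant.
    have h1 : ∀ y : E, ∫ η, (tfKernel f g y η • tfShift y η h) t =
        f t * (g (t - y) * h (t - y)) := by
      intro y
      have h2 : (𝓕 (𝓕⁻ (schwartzMul f (SchwartzMap.compSubConstCLM ℂ y g)) : 𝓢(E, ℂ))) t =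
        f t * g (t - y) := by simp
      rw [← mul_assoc, ← h2, SchwartzMap.fourier_coe, Real.fourier_eq, ← integral_mul_const]
      congr 1
      ext η
      simp only [smul_apply, tfShift_apply, smul_eq_mul, Circle.smul_def, tfKernel,
        real_inner_comm t η]
      ring
    simp_rw [h1]
    rw [integral_const_mul, integral_sub_left_eq_self (fun y => g y * h y)]
    simp [mul_comm]

/-- The complex conjugate of a Schwartz function. -/
noncomputable def schwartzConj (f : 𝓢(E, ℂ)) : 𝓢(E, ℂ) :=
  SchwartzMap.postcompCLM (𝕜 := ℝ) Complex.conjCLE.toContinuousLinearMap f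

@[simp]
theorem schwartzConj_apply (f : 𝓢(E, ℂ)) (t : E) : schwartzConj f t = starRingEnd ℂ (f t) := rfl

theorem integral_conj_mul_ne_zero (h : 𝓢(E, ℂ)) (hh : h ≠ 0) :
    ∫ t, schwartzConj h t * h t ≠ 0 := by
  have h1 : ∀ t, schwartzConj h t * h t = ((‖h t‖ ^ 2 : ℝ) : ℂ) := fun t => by
    rw [schwartzConj_apply, Complex.conj_mul']; push_cast; rfl
  have hi : Integrable fun t => ‖h t‖ ^ 2 := by
    have := (schwartzMul (schwartzConj h) h).integrable (μ := volume)
    refine this.norm.congr (Filter.Eventually.of_forall fun t => ?_)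
    simp [pow_two]
  obtain ⟨t, ht⟩ : ∃ t, h t ≠ 0 := by
    by_contra! hc
    exact hh (SchwartzMap.ext hc)
  have h2 : 0 < ∫ t, ‖h t‖ ^ 2 := by
    refine integral_pos_of_integrable_nonneg_nonzero (x := t) (h.continuous.norm.pow 2) hi
      (fun t => by positivity) (by positivity)
  simp_rw [h1]
  rw [integral_complex_ofReal]
  exact_mod_cast h2.ne'

/-- The weight `x ↦ (1 + ‖x‖) ^ (-N)` with values in `ℝ≥0∞`. -/
noncomputable def decayWeight (N : ℕ) (x : E) : ℝ≥0∞ := ENNReal.ofReal ((1 + ‖x‖) ^ N)⁻¹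

theorem decayWeight_ne_top (N : ℕ) (x : E) : decayWeight N x ≠ ∞ := ENNReal.ofReal_ne_top

theorem enorm_tfKernel_le (f g : 𝓢(E, ℂ)) (N : ℕ) : ∃ C : ℝ≥0∞, C ≠ ∞ ∧
    ∀ y η : E, ‖tfKernel f g y η‖ₑ ≤ C * decayWeight N y * decayWeight N η := by
  obtain ⟨C, hC, hle⟩ := exists_norm_tfKernel_le f g N
  refine ⟨ENNReal.ofReal C, ENNReal.ofReal_ne_top, fun y η => ?_⟩
  rw [decayWeight, decayWeight, ← ENNReal.ofReal_mul hC, ← ENNReal.ofReal_mul (by positivity),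
    ← ofReal_norm]
  refine ENNReal.ofReal_le_ofReal ?_
  have := hle y η
  rw [mul_assoc, ← mul_inv, ← div_eq_mul_inv, le_div_iff₀ (by positivity)]
  linarith

theorem measurable_enorm_apply_tfShift (L : 𝓢(E, ℂ) →L[ℂ] ℂ) (h : 𝓢(E, ℂ)) :
    Measurable fun z : E × E => ‖L (tfShift z.1 z.2 h)‖ₑ :=
  (L.continuous.comp (continuous_tfShift h)).enorm.measurable

/-- Change of window for the short-time Fourier transform. -/
theorem exists_enorm_tfShift_le (N : ℕ) (f h : 𝓢(E, ℂ)) (hh : h ≠ 0) : ∃ C : ℝ≥0∞, C ≠ ∞ ∧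
    ∀ (L : 𝓢(E, ℂ) →L[ℂ] ℂ) (x ξ : E), ‖L (tfShift x ξ f)‖ₑ ≤
      C * ∫⁻ η, decayWeight N η * ∫⁻ y, decayWeight N y *
        ‖L (tfShift (x + y) (ξ + η) h)‖ₑ := by
  obtain ⟨C, hC, hle⟩ := enorm_tfKernel_le f (schwartzConj h) N
  set c := ∫ t, schwartzConj h t * h t
  have hc : c ≠ 0 := integral_conj_mul_ne_zero h hh
  have hc' : ‖c‖ₑ ≠ 0 := enorm_ne_zero.2 hc
  refine ⟨‖c‖ₑ⁻¹ * C, ENNReal.mul_ne_top (ENNReal.inv_ne_top.2 hc') hC, fun L x ξ => ?_⟩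
  rw [mul_assoc, mul_comm ‖c‖ₑ⁻¹, ← div_eq_mul_inv,
    ENNReal.le_div_iff_mul_le (Or.inl hc') (Or.inl enorm_ne_top)]
  -- Applying the formula to the shifted functional lets a kernel independent of `(x, ξ)` serve for
  -- all shifts; the phase from composing shifts has modulus one.
  have key := integral_tfKernel_mul (L ∘L tfShift x ξ) f (schwartzConj h) h
  have hm : Measurable fun z : E × E => C * (decayWeight N z.2 * (decayWeight N z.1 *
      ‖L (tfShift (x + z.1) (ξ + z.2) h)‖ₑ)) := by
    have := (measurable_enorm_apply_tfShift L h).comp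
      (show Measurable fun z : E × E => (x + z.1, ξ + z.2) by fun_prop)
    unfold decayWeight
    fun_prop
  calc ‖L (tfShift x ξ f)‖ₑ * ‖c‖ₑ = ‖c * L (tfShift x ξ f)‖ₑ := by rw [enorm_mul, mul_comm]
    _ = ‖∫ z : E × E, tfKernel f (schwartzConj h) z.1 z.2 *
          L (tfShift x ξ (tfShift z.1 z.2 h))‖ₑ := by rw [← ContinuousLinearMap.comp_apply, key]; rfl
    _ ≤ ∫⁻ z : E × E, ‖tfKernel f (schwartzConj h) z.1 z.2 *
          L (tfShift x ξ (tfShift z.1 z.2 h))‖ₑ := enorm_integral_le_lintegral_enorm _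
    _ ≤ ∫⁻ z : E × E, C * (decayWeight N z.2 * (decayWeight N z.1 *
          ‖L (tfShift (x + z.1) (ξ + z.2) h)‖ₑ)) := by
        refine lintegral_mono fun z => ?_
        rw [tfShift_tfShift, map_smul, enorm_mul, enorm_smul]
        have : ‖((𝐞 (inner ℝ x z.2) : Circle) : ℂ)‖ₑ = 1 := by
          rw [← ofReal_norm, Circle.norm_coe]; simp
        rw [this, one_mul]
        calc _ ≤ C * decayWeight N z.1 * decayWeight N z.2 *
              ‖L (tfShift (x + z.1) (ξ + z.2) h)‖ₑ := by gcongr; exact hle _ _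
          _ = _ := by ring
    _ = C * ∫⁻ η, decayWeight N η * ∫⁻ y, decayWeight N y *
        ‖L (tfShift (x + y) (ξ + η) h)‖ₑ := by
        rw [Measure.volume_eq_prod, lintegral_prod_symm _ hm.aemeasurable,
          ← lintegral_const_mul' _ _ hC]
        congr 1
        ext η
        rw [lintegral_const_mul' _ _ hC, lintegral_const_mul' _ _ (decayWeight_ne_top _ _)]

end

/-! ### Jensen's and Minkowski's inequalities. -/

section

variable {α β : Type*} [MeasurableSpace α] [MeasurableSpace β] {μ : Measure α} {ν : Measure β}

/-- Jensen's inequality for the convex function `t ↦ t ^ p` and the measure `a dμ`. -/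
theorem lintegral_mul_rpow_le {a g : α → ℝ≥0∞} (ha : Measurable a) (hg : Measurable g) {p : ℝ}
    (hp : 1 ≤ p) :
    (∫⁻ x, a x * g x ∂μ) ^ p ≤ (∫⁻ x, a x ∂μ) ^ (p - 1) * ∫⁻ x, a x * g x ^ p ∂μ := by
  have hp0 : 0 < p := zero_lt_one.trans_le hp
  have h1 := eLpNorm'_le_eLpNorm'_mul_rpow_measure_univ (μ := μ.withDensity a) zero_lt_one hp
    hg.aestronglyMeasurable
  simp only [eLpNorm', enorm_eq_self, ENNReal.rpow_one, div_one] at h1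
  rw [lintegral_withDensity_eq_lintegral_mul μ ha hg,
    lintegral_withDensity_eq_lintegral_mul μ ha (hg.pow_const p),
    withDensity_apply _ MeasurableSet.univ, Measure.restrict_univ] at h1
  have h2 := ENNReal.rpow_le_rpow h1 hp0.le
  rw [ENNReal.mul_rpow_of_nonneg _ _ hp0.le, ← ENNReal.rpow_mul, ← ENNReal.rpow_mul,
    one_div_mul_cancel hp0.ne', ENNReal.rpow_one] at h2
  have h3 : (1 - 1 / p) * p = p - 1 := by field_simp
  rw [h3] at h2
  exact h2.trans_eq (mul_comm _ _)

theorem measurable_rpow_lintegral_rpow [SFinite μ] {g : α → β → ℝ≥0∞}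
    (hg : Measurable (Function.uncurry g)) (p : ℝ) :
    Measurable fun y => (∫⁻ x, g x y ^ p ∂μ) ^ (1 / p) :=
  (Measurable.lintegral_prod_left' (hg.pow_const p)).pow_const (1 / p)

/-- Minkowski's integral inequality. -/
theorem rpow_lintegral_rpow_lintegral_le [SFinite μ] [SFinite ν] {g : α → β → ℝ≥0∞}
    (hg : Measurable (Function.uncurry g)) {p : ℝ} (hp : 1 ≤ p) :
    (∫⁻ x, (∫⁻ y, g x y ∂ν) ^ p ∂μ) ^ (1 / p) ≤ ∫⁻ y, (∫⁻ x, g x y ^ p ∂μ) ^ (1 / p) ∂ν := by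
  have hp0 : 0 < p := zero_lt_one.trans_le hp
  set c : β → ℝ≥0∞ := fun y => (∫⁻ x, g x y ^ p ∂μ) ^ (1 / p) with hc
  have hcm : Measurable c := measurable_rpow_lintegral_rpow hg p
  have hcp : ∀ y, c y ^ p = ∫⁻ x, g x y ^ p ∂μ := fun y => by
    rw [hc, ← ENNReal.rpow_mul, one_div_mul_cancel hp0.ne', ENNReal.rpow_one]
  by_cases htop : ∫⁻ y, c y ∂ν = ∞
  · rw [htop]; exact le_top
  have hgy : ∀ y, Measurable fun x => g x y := fun y => hg.of_uncurry_right
  have hgx : ∀ x, Measurable fun y => g x y := fun x => hg.of_uncurry_left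
  -- Dividing by `c y` is safe almost everywhere: `c` is finite a.e., and where `c y = 0` the
  -- function `g · y` vanishes a.e.
  have hae : ∀ᵐ x ∂μ, ∀ᵐ y ∂ν, g x y ≤ c y * (g x y / c y) := by
    rw [Measure.ae_ae_comm]
    · filter_upwards [ae_lt_top hcm htop] with y hy
      by_cases hy0 : c y = 0
      · have h0 : ∫⁻ x, g x y ^ p ∂μ = 0 := by
          rw [← hcp, hy0, ENNReal.zero_rpow_of_pos hp0]
        rw [lintegral_eq_zero_iff ((hgy y).pow_const p)] at h0
        filter_upwards [h0] with x hx
        have : g x y = 0 := by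
          simpa [ENNReal.rpow_eq_zero_iff, hp0, hp0.not_gt] using hx
        simp [this]
      · exact Filter.Eventually.of_forall fun x => by
          rw [ENNReal.mul_div_cancel hy0 hy.ne]
    · exact measurableSet_le hg ((hcm.comp measurable_snd).mul (hg.div (hcm.comp measurable_snd)))
  have hm : Measurable (Function.uncurry fun x y => c y * (g x y / c y) ^ p) :=
    (hcm.comp measurable_snd).mul ((hg.div (hcm.comp measurable_snd)).pow_const p)
  -- Jensen for the measure `c dν`, applied to `g / c`, whose p-th power has `μ`-integral at most 1
  -- for each `y`; no duality is needed.
  have h1 : ∫⁻ x, (∫⁻ y, g x y ∂ν) ^ p ∂μ ≤ (∫⁻ y, c y ∂ν) ^ p := by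
    calc ∫⁻ x, (∫⁻ y, g x y ∂ν) ^ p ∂μ
        ≤ ∫⁻ x, (∫⁻ y, c y ∂ν) ^ (p - 1) * ∫⁻ y, c y * (g x y / c y) ^ p ∂ν ∂μ := by
          refine lintegral_mono_ae ?_
          filter_upwards [hae] with x hx
          exact (ENNReal.rpow_le_rpow (lintegral_mono_ae hx) hp0.le).trans
            (lintegral_mul_rpow_le hcm ((hgx x).div hcm) hp)
      _ = (∫⁻ y, c y ∂ν) ^ (p - 1) * ∫⁻ y, ∫⁻ x, c y * (g x y / c y) ^ p ∂μ ∂ν := by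
          have hm' : Measurable fun x => ∫⁻ y, c y * (g x y / c y) ^ p ∂ν :=
            hm.lintegral_prod_right'
          rw [lintegral_const_mul _ hm', lintegral_lintegral_swap hm.aemeasurable]
      _ ≤ (∫⁻ y, c y ∂ν) ^ (p - 1) * ∫⁻ y, c y ∂ν := by
          gcongr with y
          rw [lintegral_const_mul _ (((hgy y).div_const _).pow_const p)]
          simp_rw [ENNReal.div_rpow_of_nonneg _ _ hp0.le, div_eq_mul_inv]
          rw [lintegral_mul_const _ ((hgy y).pow_const p), ← hcp]
          exact mul_le_of_le_one_right' (ENNReal.mul_inv_le_one _)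
      _ = (∫⁻ y, c y ∂ν) ^ p := by
          by_cases h0 : ∫⁻ y, c y ∂ν = 0
          · rw [h0, mul_zero, ENNReal.zero_rpow_of_pos hp0]
          · nth_rw 2 [← ENNReal.rpow_one (∫⁻ y, c y ∂ν)]
            rw [← ENNReal.rpow_add _ _ h0 htop]
            simp
  calc _ ≤ ((∫⁻ y, c y ∂ν) ^ p) ^ (1 / p) := ENNReal.rpow_le_rpow h1 (by positivity)
    _ = _ := by rw [← ENNReal.rpow_mul, mul_one_div_cancel hp0.ne', ENNReal.rpow_one]

end

/-! ### The frequency weight. -/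

section

variable {E : Type*} [NormedAddCommGroup E] [NormedSpace ℝ E]

/-- The weight `(1 + ‖2πξ‖²) ^ (s / 2)`. -/
noncomputable def weight (s : ℝ) (ξ : E) : ℝ≥0∞ :=
  ENNReal.ofReal ((1 + ‖(2 * Real.pi) • ξ‖ ^ 2) ^ (s / 2))

theorem weight_ne_top (s : ℝ) (ξ : E) : weight s ξ ≠ ∞ := ENNReal.ofReal_ne_top

theorem one_le_weight {s : ℝ} (hs : 0 ≤ s) (ξ : E) : 1 ≤ weight s ξ := by
  rw [weight, ← ENNReal.ofReal_one]
  exact ENNReal.ofReal_le_ofReal (Real.one_le_rpow (by nlinarith [norm_nonneg ((2 * Real.pi) • ξ)])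
    (by positivity))

theorem measurable_weight [MeasurableSpace E] [BorelSpace E] (s : ℝ) :
    Measurable (weight (E := E) s) := by
  have : Continuous fun ξ : E => (1 + ‖(2 * Real.pi) • ξ‖ ^ 2) ^ (s / 2) :=
    Continuous.rpow_const (by fun_prop) fun ξ => Or.inl (by positivity)
  exact ENNReal.measurable_ofReal.comp this.measurable

/-- From `1 + |a + b|² ≤ 2 (1 + |a|²) (1 + |b|²)`; this submultiplicativity makes weighted L¹ stable
under convolution. -/
theorem weight_add_le {s : ℝ} (hs : 0 ≤ s) (ξ η : E) :
    weight s (ξ + η) ≤ ENNReal.ofReal (2 ^ (s / 2)) * (weight s ξ * weight s η) := by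
  rw [weight, weight, weight, ← ENNReal.ofReal_mul (by positivity),
    ← ENNReal.ofReal_mul (by positivity), ← Real.mul_rpow (by positivity) (by positivity),
    ← Real.mul_rpow (by positivity) (by positivity), smul_add]
  refine ENNReal.ofReal_le_ofReal (Real.rpow_le_rpow (by positivity) ?_ (by positivity))
  set a := (2 * Real.pi) • ξ
  set b := (2 * Real.pi) • η
  have h := norm_add_le a b
  have h' : ‖a + b‖ ^ 2 ≤ (‖a‖ + ‖b‖) ^ 2 := by gcongr
  nlinarith [sq_nonneg (‖a‖ - ‖b‖), mul_nonneg (sq_nonneg ‖a‖) (sq_nonneg ‖b‖)]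

theorem exists_weight_mul_decayWeight_le {s : ℝ} (hs : 0 ≤ s) (N : ℕ) : ∃ C : ℝ≥0∞, C ≠ ∞ ∧
    ∀ ξ : E, weight s ξ * decayWeight (N + ⌈s⌉₊) ξ ≤ C * decayWeight N ξ := by
  refine ⟨ENNReal.ofReal ((1 + 2 * Real.pi) ^ ⌈s⌉₊), ENNReal.ofReal_ne_top, fun ξ => ?_⟩
  rw [weight, decayWeight, decayWeight, ← ENNReal.ofReal_mul (by positivity),
    ← ENNReal.ofReal_mul (by positivity)]
  refine ENNReal.ofReal_le_ofReal ?_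
  have hpi := Real.pi_pos
  rw [← div_eq_mul_inv, ← div_eq_mul_inv, div_le_div_iff₀ (by positivity) (by positivity)]
  have h1 : (1 + ‖(2 * Real.pi) • ξ‖ ^ 2) ^ (s / 2) ≤ ((1 + 2 * Real.pi) * (1 + ‖ξ‖)) ^ ⌈s⌉₊ := by
    have hn : ‖(2 * Real.pi) • ξ‖ = 2 * Real.pi * ‖ξ‖ := by
      rw [norm_smul, Real.norm_of_nonneg (by positivity)]
    have h2 : 1 + ‖(2 * Real.pi) • ξ‖ ^ 2 ≤ ((1 + 2 * Real.pi) * (1 + ‖ξ‖)) ^ 2 := by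
      rw [hn]
      have h3 : 1 + (2 * Real.pi * ‖ξ‖) ^ 2 ≤ (1 + 2 * Real.pi * ‖ξ‖) ^ 2 := by
        nlinarith [mul_nonneg hpi.le (norm_nonneg ξ)]
      refine h3.trans ?_
      gcongr
      nlinarith [norm_nonneg ξ]
    have h4 : (1 : ℝ) ≤ (1 + 2 * Real.pi) * (1 + ‖ξ‖) := by
      nlinarith [norm_nonneg ξ, mul_nonneg hpi.le (norm_nonneg ξ)]
    calc (1 + ‖(2 * Real.pi) • ξ‖ ^ 2) ^ (s / 2)
        ≤ (((1 + 2 * Real.pi) * (1 + ‖ξ‖)) ^ 2) ^ (s / 2) := by gcongr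
      _ = ((1 + 2 * Real.pi) * (1 + ‖ξ‖)) ^ s := by
          rw [← Real.rpow_natCast, ← Real.rpow_mul (by positivity)]
          congr 1; push_cast; ring
      _ ≤ ((1 + 2 * Real.pi) * (1 + ‖ξ‖)) ^ (⌈s⌉₊ : ℝ) :=
          Real.rpow_le_rpow_of_exponent_le h4 (Nat.le_ceil s)
      _ = _ := Real.rpow_natCast _ _
  calc _ ≤ ((1 + 2 * Real.pi) * (1 + ‖ξ‖)) ^ ⌈s⌉₊ * (1 + ‖ξ‖) ^ N := by gcongr
    _ = _ := by rw [mul_pow, pow_add]; ring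

end

/-! ### Mixed norms under convolution in frequency and averaging in position. -/

section

variable {E : Type*} [NormedAddCommGroup E] [InnerProductSpace ℝ E] [FiniteDimensional ℝ E]
  [MeasurableSpace E] [BorelSpace E]

theorem measurable_decayWeight (N : ℕ) : Measurable (decayWeight (E := E) N) := by
  unfold decayWeight
  fun_prop

theorem decayWeight_le_one (N : ℕ) (x : E) : decayWeight N x ≤ 1 := by
  rw [decayWeight, ← ENNReal.ofReal_one]
  refine ENNReal.ofReal_le_ofReal (inv_le_one_of_one_le₀ (one_le_pow₀ ?_))
  linarith [norm_nonneg x]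

theorem lintegral_decayWeight_ne_top :
    ∫⁻ x : E, decayWeight (Module.finrank ℝ E + 1) x ≠ ∞ := by
  have h := (integrable_one_add_norm_pow_inv (E := E)).lintegral_lt_top
  exact h.ne

theorem lintegral_weight_mul_decayWeight_ne_top {s : ℝ} (hs : 0 ≤ s) :
    ∫⁻ ξ : E, weight s ξ * decayWeight (Module.finrank ℝ E + 1 + ⌈s⌉₊) ξ ≠ ∞ := by
  obtain ⟨C, hC, h⟩ := exists_weight_mul_decayWeight_le (E := E) hs (Module.finrank ℝ E + 1)
  refine ne_top_of_le_ne_top ?_ (lintegral_mono h)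
  rw [lintegral_const_mul' _ _ hC]
  exact ENNReal.mul_ne_top hC lintegral_decayWeight_ne_top

/-- The mixed norm `∫ w(ξ) ‖F(·, ξ)‖_p dξ`. -/
noncomputable def mixedNorm (p s : ℝ) (F : E → E → ℝ≥0∞) : ℝ≥0∞ :=
  ∫⁻ ξ, weight s ξ * (∫⁻ x, F x ξ ^ p) ^ (1 / p)

theorem mixedNorm_mono {p s : ℝ} (hp : 1 ≤ p) {F G : E → E → ℝ≥0∞} (h : ∀ x ξ, F x ξ ≤ G x ξ) :
    mixedNorm p s F ≤ mixedNorm p s G := by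
  have hp0 : 0 ≤ p := zero_le_one.trans hp
  unfold mixedNorm
  gcongr with ξ x
  exact h x ξ

theorem lintegral_weight_mul_conv_le {s : ℝ} (hs : 0 ≤ s) {B f : E → ℝ≥0∞} (hB : Measurable B)
    (hf : Measurable f) : ∫⁻ ξ, weight s ξ * ∫⁻ η, B η * f (ξ - η) ≤
      ENNReal.ofReal (2 ^ (s / 2)) * (∫⁻ η, weight s η * B η) * ∫⁻ ξ, weight s ξ * f ξ := by
  have hw := measurable_weight (E := E) s
  have hwf : Measurable fun ξ => weight s ξ * f ξ := hw.mul hf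
  have hwB : Measurable fun ξ => weight s ξ * B ξ := hw.mul hB
  have hm : Measurable (Function.uncurry fun ξ η : E => weight s ξ * (B η * f (ξ - η))) :=
    (hw.comp measurable_fst).mul ((hB.comp measurable_snd).mul (hf.comp (by fun_prop)))
  calc ∫⁻ ξ, weight s ξ * ∫⁻ η, B η * f (ξ - η)
      = ∫⁻ ξ, ∫⁻ η, weight s ξ * (B η * f (ξ - η)) := by
        congr 1; ext ξ
        rw [lintegral_const_mul' _ _ (weight_ne_top _ _)]
    _ = ∫⁻ η, ∫⁻ ξ, weight s ξ * (B η * f (ξ - η)) := lintegral_lintegral_swap hm.aemeasurable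
    _ ≤ ∫⁻ η, ENNReal.ofReal (2 ^ (s / 2)) * (weight s η * B η) * ∫⁻ ξ, weight s ξ * f ξ := by
        refine lintegral_mono fun η => ?_
        rw [← lintegral_const_mul _ hwf,
          ← lintegral_sub_right_eq_self (fun ξ => _ * (weight s ξ * f ξ)) η]
        refine lintegral_mono fun ξ => ?_
        have := weight_add_le hs (ξ - η) η
        rw [sub_add_cancel] at this
        calc weight s ξ * (B η * f (ξ - η))
            ≤ ENNReal.ofReal (2 ^ (s / 2)) * (weight s (ξ - η) * weight s η) *
              (B η * f (ξ - η)) := by gcongr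
          _ = _ := by ring
    _ = _ := by
        rw [lintegral_mul_const _ (hwB.const_mul _), lintegral_const_mul _ hwB]

/-- Minkowski in the position variable reduces the claim to the weighted Young inequality in
frequency. -/
theorem mixedNorm_le_of_le_conv {p s : ℝ} (hp : 1 ≤ p) (hs : 0 ≤ s) {V F : E → E → ℝ≥0∞}
    {B : E → ℝ≥0∞} (hF : Measurable (Function.uncurry F)) (hB : Measurable B)
    (h : ∀ x ξ, V x ξ ≤ ∫⁻ η, B η * F x (ξ - η)) :
    mixedNorm p s V ≤
      ENNReal.ofReal (2 ^ (s / 2)) * (∫⁻ η, weight s η * B η) * mixedNorm p s F := by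
  have hp0 : 0 < p := zero_lt_one.trans_le hp
  refine (mixedNorm_mono hp h).trans ?_
  refine le_trans (lintegral_mono fun ξ => ?_)
    (lintegral_weight_mul_conv_le hs hB (measurable_rpow_lintegral_rpow hF p))
  gcongr
  refine (rpow_lintegral_rpow_lintegral_le (g := fun x η => B η * F x (ξ - η)) ?_ hp).trans ?_
  · exact (hB.comp measurable_snd).mul (hF.comp (show Measurable fun z : E × E => (z.1, ξ - z.2) by
      fun_prop))
  · refine lintegral_mono fun η => ?_
    have hF' : Measurable fun x => F x (ξ - η) := hF.of_uncurry_right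
    simp_rw [ENNReal.mul_rpow_of_nonneg _ _ hp0.le]
    rw [lintegral_const_mul _ (hF'.pow_const p), ENNReal.mul_rpow_of_nonneg _ _ (by positivity),
      ← ENNReal.rpow_mul, mul_one_div_cancel hp0.ne', ENNReal.rpow_one]

theorem mixedNorm_translate_average_le {p s : ℝ} (hp : 1 ≤ p) {F : E → E → ℝ≥0∞} {a : E → ℝ≥0∞}
    (hF : Measurable (Function.uncurry F)) (ha : Measurable a) :
    mixedNorm p s (fun x ξ => ∫⁻ y, a y * F (x + y) ξ) ≤ (∫⁻ y, a y) * mixedNorm p s F := by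
  have hp0 : 0 < p := zero_lt_one.trans_le hp
  have hm : Measurable fun ξ => weight s ξ * (∫⁻ x, F x ξ ^ p) ^ (1 / p) :=
    (measurable_weight (E := E) s).mul
    (measurable_rpow_lintegral_rpow (μ := (volume : Measure E)) hF p)
  rw [mixedNorm, mixedNorm, ← lintegral_const_mul _ hm]
  refine lintegral_mono fun ξ => ?_
  have hFξ : Measurable fun x => F x ξ := hF.of_uncurry_right
  have h1 := rpow_lintegral_rpow_lintegral_le (μ := (volume : Measure E))
    (ν := (volume : Measure E)) (g := fun x y => a y * F (x + y) ξ)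
    ((ha.comp measurable_snd).mul (hFξ.comp (by fun_prop))) hp
  have h2 : ∀ y : E, (∫⁻ x, (a y * F (x + y) ξ) ^ p) ^ (1 / p) =
      a y * (∫⁻ x, F x ξ ^ p) ^ (1 / p) := fun y => by
    have hF' : Measurable fun x => F (x + y) ξ := hFξ.comp (measurable_add_const y)
    simp_rw [ENNReal.mul_rpow_of_nonneg _ _ hp0.le]
    rw [lintegral_const_mul _ (hF'.pow_const p), ENNReal.mul_rpow_of_nonneg _ _ (by positivity),
      ← ENNReal.rpow_mul, mul_one_div_cancel hp0.ne', ENNReal.rpow_one,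
      lintegral_add_right_eq_self (fun x => F x ξ ^ p) y]
  simp_rw [h2] at h1
  rw [lintegral_mul_const _ ha] at h1
  calc _ ≤ weight s ξ * ((∫⁻ y, a y) * (∫⁻ x, F x ξ ^ p) ^ (1 / p)) := by gcongr
    _ = _ := by ring

/-- Jensen for the measure `a dy`, after which `a ≤ 1` is discarded. The bound no longer depends on
`x`, so local averages pass from L^p to L^∞. -/
theorem translate_average_le {p : ℝ} (hp : 1 ≤ p) {f : E → ℝ≥0∞} {a : E → ℝ≥0∞}
    (hf : Measurable f) (ha : Measurable a) (ha1 : ∀ y, a y ≤ 1) (x : E) :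
    ∫⁻ y, a y * f (x + y) ≤ (∫⁻ y, a y) ^ ((p - 1) / p) * (∫⁻ y, f y ^ p) ^ (1 / p) := by
  have hp0 : 0 < p := zero_lt_one.trans_le hp
  have h1 := lintegral_mul_rpow_le (μ := (volume : Measure E)) ha
    (hf.comp (show Measurable fun y => x + y by fun_prop)) hp
  have h2 : ∫⁻ y, a y * f (x + y) ^ p ≤ ∫⁻ y, f y ^ p := by
    rw [← lintegral_add_left_eq_self (fun y => f y ^ p) x]
    exact lintegral_mono fun y => mul_le_of_le_one_left' (ha1 y)
  have h3 := ENNReal.rpow_le_rpow (h1.trans (mul_le_mul_right h2 _)) (z := 1 / p) (by positivity)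
  rw [← ENNReal.rpow_mul, mul_one_div_cancel hp0.ne', ENNReal.rpow_one,
    ENNReal.mul_rpow_of_nonneg _ _ (by positivity), ← ENNReal.rpow_mul, mul_one_div] at h3
  exact h3

/-- The position average may be measured in L^p, by translation invariance, or bounded uniformly in
`x` by Jensen. In either case weighted Young handles the frequency convolution. -/
theorem exists_mixedNorm_le_of_le_average {p s : ℝ} (hp : 1 ≤ p) (hs : 0 ≤ s) {b : E → ℝ≥0∞}
    {C : ℝ≥0∞} (hC : C ≠ ∞) (hbm : Measurable b) (hb0 : ∀ x, b x ≤ 1)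
    (hb2 : ∫⁻ y, weight s y * b y ≠ ∞) : ∃ K : ℝ≥0∞, K ≠ ∞ ∧ ∀ V F : E → E → ℝ≥0∞,
      Measurable (Function.uncurry F) →
      (∀ x ξ, V x ξ ≤ ∫⁻ η, (C * b η) * ∫⁻ y, b y * F (x + y) (ξ - η)) →
      mixedNorm p s V ≤ K * mixedNorm p s F ∧
      ∃ B : E → ℝ≥0∞, Measurable B ∧ (∀ x ξ, V x ξ ≤ B ξ) ∧
        ∫⁻ ξ, weight s ξ * B ξ ≤ K * mixedNorm p s F := by
  have hp0 : 0 < p := zero_lt_one.trans_le hp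
  have hb1 : ∫⁻ y, b y ≠ ∞ := ne_top_of_le_ne_top hb2
    (lintegral_mono fun ξ => le_mul_of_one_le_left' (one_le_weight hs ξ))
  set C₂ := ENNReal.ofReal (2 ^ (s / 2)) * (∫⁻ y, weight s y * (C * b y)) with hC₂
  have hC₂' : C₂ ≠ ∞ := by
    refine ENNReal.mul_ne_top ENNReal.ofReal_ne_top ?_
    simp_rw [mul_left_comm _ C]
    rw [lintegral_const_mul' _ _ hC]
    exact ENNReal.mul_ne_top hC hb2
  set A := (∫⁻ y, b y) ^ ((p - 1) / p) with hA
  have hA' : A ≠ ∞ := ENNReal.rpow_ne_top_of_nonneg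
    (div_nonneg (by linarith) hp0.le) hb1
  refine ⟨max (C₂ * ∫⁻ y, b y) (C₂ * A), ?_, fun V F hFm hle => ⟨?_, ?_⟩⟩
  · exact (max_lt (ENNReal.mul_lt_top hC₂'.lt_top hb1.lt_top)
      (ENNReal.mul_lt_top hC₂'.lt_top hA'.lt_top)).ne
  · have hFa : Measurable (Function.uncurry fun x ξ => ∫⁻ y, b y * F (x + y) ξ) := by
      refine Measurable.lintegral_prod_right' (f := fun z : (E × E) × E =>
        b z.2 * F (z.1.1 + z.2) z.1.2) ?_
      exact (hbm.comp measurable_snd).mul (hFm.comp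
        (show Measurable fun z : (E × E) × E => (z.1.1 + z.2, z.1.2) by fun_prop))
    refine (mixedNorm_le_of_le_conv hp hs hFa (hbm.const_mul C) hle).trans ?_
    refine (mul_le_mul_right (mixedNorm_translate_average_le hp hFm hbm) _).trans ?_
    rw [← mul_assoc]
    exact mul_le_mul_left (le_max_left _ _) _
  · set φ : E → ℝ≥0∞ := fun ξ => (∫⁻ x, F x ξ ^ p) ^ (1 / p)
    have hφ : Measurable φ := measurable_rpow_lintegral_rpow hFm p
    refine ⟨fun ξ => ∫⁻ η, (C * b η) * (A * φ (ξ - η)), ?_, fun x ξ => ?_, ?_⟩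
    · refine Measurable.lintegral_prod_right' (f := fun z : E × E =>
        (C * b z.2) * (A * φ (z.1 - z.2))) ?_
      exact ((hbm.comp measurable_snd).const_mul C).mul
        ((hφ.comp (show Measurable fun z : E × E => z.1 - z.2 by fun_prop)).const_mul A)
    · refine (hle x ξ).trans (lintegral_mono fun η => ?_)
      gcongr
      exact translate_average_le hp hFm.of_uncurry_right hbm hb0 x
    · refine (lintegral_weight_mul_conv_le hs (hbm.const_mul C) (hφ.const_mul A)).trans ?_
      simp_rw [mul_left_comm _ A]
      rw [lintegral_const_mul' _ _ hA', ← mul_assoc]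
      exact mul_le_mul_left (le_max_right _ _) _

/-- The window can be changed in the mixed norm of the short-time Fourier transform, and the
transform is dominated, uniformly in the time variable, by a function of the frequency. -/
theorem exists_mixedNorm_tfShift_le {p s : ℝ} (hp : 1 ≤ p) (hs : 0 ≤ s) (f h : 𝓢(E, ℂ))
    (hh : h ≠ 0) : ∃ C : ℝ≥0∞, C ≠ ∞ ∧ ∀ L : 𝓢(E, ℂ) →L[ℂ] ℂ,
      mixedNorm p s (fun x ξ => ‖L (tfShift x ξ f)‖ₑ) ≤
        C * mixedNorm p s (fun x ξ => ‖L (tfShift x ξ h)‖ₑ) ∧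
      ∃ B : E → ℝ≥0∞, Measurable B ∧ (∀ x ξ, ‖L (tfShift x ξ f)‖ₑ ≤ B ξ) ∧
        ∫⁻ ξ, weight s ξ * B ξ ≤ C * mixedNorm p s (fun x ξ => ‖L (tfShift x ξ h)‖ₑ) := by
  obtain ⟨C, hC, hle⟩ := exists_enorm_tfShift_le (Module.finrank ℝ E + 1 + ⌈s⌉₊) f h hh
  obtain ⟨K, hK, hK'⟩ := exists_mixedNorm_le_of_le_average (E := E) hp hs hC
    (measurable_decayWeight (Module.finrank ℝ E + 1 + ⌈s⌉₊)) (decayWeight_le_one _)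
    (lintegral_weight_mul_decayWeight_ne_top hs)
  refine ⟨K, hK, fun L => hK' _ _ (measurable_enorm_apply_tfShift L h) fun x ξ => ?_⟩
  refine (hle L x ξ).trans_eq ?_
  -- Reflecting `η` turns `ξ + η` into a convolution variable; the decay weight is even.
  rw [← lintegral_neg_eq_self, ← lintegral_const_mul' _ _ hC]
  simp only [decayWeight, norm_neg, ← sub_eq_add_neg, mul_assoc]

end

/-! ### Inversion of the transform and the continuous representative. -/

section

variable {E : Type*} [NormedAddCommGroup E] [InnerProductSpace ℝ E] [FiniteDimensional ℝ E]
  [MeasurableSpace E] [BorelSpace E]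

/-- The mixed norm of the short-time Fourier transform of `L` with window `conj h`. -/
noncomputable def stftNorm (h : 𝓢(E, ℂ)) (p s : ℝ) (L : 𝓢(E, ℂ) →L[ℂ] ℂ) : ℝ≥0∞ :=
  mixedNorm p s fun x ξ => ‖L (tfShift x ξ h)‖ₑ

/-- The functional `L` is integration against the continuous function `u`. -/
def Represents (L : 𝓢(E, ℂ) →L[ℂ] ℂ) (u : E → ℂ) : Prop :=
  Continuous u ∧ ∀ g : 𝓢(E, ℂ), Integrable (fun t => g t * u t) ∧ L g = ∫ t, g t * u t

theorem Represents.unique {L : 𝓢(E, ℂ) →L[ℂ] ℂ} {u v : E → ℂ} (hu : Represents L u)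
    (hv : Represents L v) : u = v := by
  refine (Continuous.ae_eq_iff_eq (volume : Measure E) hu.1 hv.1).1 ?_
  refine ae_eq_of_integral_contDiff_smul_eq (μ := volume) hu.1.locallyIntegrable
    hv.1.locallyIntegrable fun g hg hgc => ?_
  obtain ⟨G, hG⟩ : ∃ G : 𝓢(E, ℂ), ∀ t, G t = g t :=
    ⟨(hgc.comp_left Complex.ofReal_zero).toSchwartzMap (Complex.ofRealCLM.contDiff.comp hg),
      fun _ => rfl⟩
  have h1 := (hu.2 G).2.symm.trans (hv.2 G).2
  simpa only [hG, Complex.real_smul] using h1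

theorem Represents.add {L M : 𝓢(E, ℂ) →L[ℂ] ℂ} {u v : E → ℂ} (hu : Represents L u)
    (hv : Represents M v) : Represents (L + M) (u + v) := by
  refine ⟨hu.1.add hv.1, fun g => ?_⟩
  have h : (fun t => g t * (u + v) t) = (fun t => g t * u t) + fun t => g t * v t := by
    ext t; simp [mul_add]
  rw [h]
  refine ⟨(hu.2 g).1.add (hv.2 g).1, ?_⟩
  rw [integral_add' (hu.2 g).1 (hv.2 g).1, add_apply, (hu.2 g).2, (hv.2 g).2]

theorem Represents.smul {L : 𝓢(E, ℂ) →L[ℂ] ℂ} {u : E → ℂ} (c : ℂ) (hu : Represents L u) :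
    Represents (c • L) (c • u) := by
  refine ⟨hu.1.const_smul c, fun g => ?_⟩
  have h : (fun t => g t * (c • u) t) = fun t => c * (g t * u t) := by
    ext t; simp; ring
  rw [h]
  refine ⟨(hu.2 g).1.const_mul c, ?_⟩
  rw [integral_const_mul, smul_apply, (hu.2 g).2, smul_eq_mul]

theorem norm_le_decay (g : 𝓢(E, ℂ)) (N : ℕ) : ∃ A : ℝ, 0 ≤ A ∧
    ∀ x : E, ‖g x‖ ≤ A * ((1 + ‖x‖) ^ N)⁻¹ := by
  refine ⟨2 ^ N * schwartzSup (N, 0) g, by positivity, fun x => ?_⟩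
  rw [← div_eq_mul_inv, le_div_iff₀ (by positivity), mul_comm]
  exact norm_le_schwartzSup N g x

theorem decay_sub_le (N : ℕ) (x y : E) :
    ((1 + ‖x - y‖) ^ N)⁻¹ ≤ (1 + ‖x‖) ^ N * ((1 + ‖y‖) ^ N)⁻¹ := by
  rw [← div_eq_mul_inv, inv_eq_one_div, div_le_div_iff₀ (by positivity) (by positivity), one_mul,
    ← mul_pow]
  gcongr
  have := one_add_norm_le_mul y x
  rw [norm_sub_rev] at this
  linarith

/-- At each frequency this is the position average around `t`, bounded independently of `t`; hence
both the convergence of the inversion integral and its sup bound. -/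
theorem lintegral_decayWeight_translate_le {p s : ℝ} (hp : 1 ≤ p) (hs : 0 ≤ s)
    {F : E → E → ℝ≥0∞} (hF : Measurable (Function.uncurry F)) (t : E) :
    ∫⁻ z : E × E, decayWeight (Module.finrank ℝ E + 1) (t - z.1) * F z.1 z.2 ≤
      (∫⁻ y : E, decayWeight (Module.finrank ℝ E + 1) y) ^ ((p - 1) / p) * mixedNorm p s F := by
  set D := Module.finrank ℝ E + 1
  have hw : Measurable (decayWeight (E := E) D) := measurable_decayWeight D
  have hp0 : 0 < p := zero_lt_one.trans_le hp
  have hA : (∫⁻ y : E, decayWeight D y) ^ ((p - 1) / p) ≠ ∞ :=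
    ENNReal.rpow_ne_top_of_nonneg (div_nonneg (by linarith) hp0.le) lintegral_decayWeight_ne_top
  have hm : Measurable fun z : E × E => decayWeight D (t - z.1) * F z.1 z.2 :=
    (hw.comp (show Measurable fun z : E × E => t - z.1 by fun_prop)).mul hF
  rw [Measure.volume_eq_prod, lintegral_prod_symm _ hm.aemeasurable, mixedNorm,
    ← lintegral_const_mul' _ _ hA]
  refine lintegral_mono fun η => ?_
  have h1 := translate_average_le hp (hF.of_uncurry_right (y := η)) hw (decayWeight_le_one D) t
  have h2 : ∫⁻ y, decayWeight D (t - y) * F y η = ∫⁻ y, decayWeight D y * F (t + y) η := by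
    rw [← lintegral_add_left_eq_self _ t]
    simp [decayWeight]
  calc _ = ∫⁻ y, decayWeight D y * F (t + y) η := h2
    _ ≤ _ := h1
    _ ≤ _ := by gcongr; exact le_mul_of_one_le_left' (one_le_weight hs η)

/-- The inversion formula for the short-time Fourier transform, up to a constant factor. -/
noncomputable def stftInverse (γ : 𝓢(E, ℂ)) (F : E × E → ℂ) (t : E) : ℂ :=
  ∫ z : E × E, (𝐞 (inner ℝ t z.2) : ℂ) * γ (t - z.1) * F z

section inverse

variable {γ : 𝓢(E, ℂ)} {F : E × E → ℂ}

theorem continuous_stftInverse_integrand (hF : Continuous F) :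
    Continuous fun w : E × (E × E) =>
      (𝐞 (inner ℝ w.1 w.2.2) : ℂ) * γ (w.1 - w.2.1) * F w.2 := by
  have h1 : Continuous fun w : E × (E × E) => 𝐞 (inner ℝ w.1 w.2.2) :=
    Real.continuous_fourierChar.comp (by fun_prop)
  have h2 := γ.continuous
  have h3 : Continuous fun w : E × (E × E) => (𝐞 (inner ℝ w.1 w.2.2) : ℂ) :=
    continuous_subtype_val.comp h1
  fun_prop

theorem exists_stftInverse_integrand_le (γ : 𝓢(E, ℂ)) (F : E × E → ℂ) : ∃ A : ℝ, 0 ≤ A ∧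
    ∀ (t : E) (z : E × E), ‖(𝐞 (inner ℝ t z.2) : ℂ) * γ (t - z.1) * F z‖ ≤
      A * ((1 + ‖t‖) ^ (Module.finrank ℝ E + 1) *
        (((1 + ‖z.1‖) ^ (Module.finrank ℝ E + 1))⁻¹ * ‖F z‖)) := by
  obtain ⟨A, hA, h⟩ := norm_le_decay γ (Module.finrank ℝ E + 1)
  refine ⟨A, hA, fun t z => ?_⟩
  rw [norm_mul, norm_mul, Circle.norm_coe, one_mul]
  calc ‖γ (t - z.1)‖ * ‖F z‖
      ≤ A * ((1 + ‖t‖) ^ (Module.finrank ℝ E + 1) *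
        ((1 + ‖z.1‖) ^ (Module.finrank ℝ E + 1))⁻¹) * ‖F z‖ := by
        gcongr
        exact (h _).trans (mul_le_mul_of_nonneg_left (decay_sub_le _ _ _) hA)
    _ = _ := by ring

theorem continuous_stftInverse (hF : Continuous F) (hint : Integrable fun z : E × E =>
    ((1 + ‖z.1‖) ^ (Module.finrank ℝ E + 1))⁻¹ * ‖F z‖) : Continuous (stftInverse γ F) := by
  obtain ⟨A, hA, h⟩ := exists_stftInverse_integrand_le γ F
  have hc := continuous_stftInverse_integrand (γ := γ) hF
  rw [continuous_iff_continuousAt]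
  intro t₀
  refine continuousAt_of_dominated (bound := fun z =>
    A * ((1 + (‖t₀‖ + 1)) ^ (Module.finrank ℝ E + 1) *
        (((1 + ‖z.1‖) ^ (Module.finrank ℝ E + 1))⁻¹ * ‖F z‖))) ?_ ?_ ?_ ?_
  · exact Filter.Eventually.of_forall fun t =>
      (hc.comp (by fun_prop : Continuous fun z : E × E => (t, z))).aestronglyMeasurable
  · filter_upwards [Metric.ball_mem_nhds t₀ one_pos] with t ht
    refine Filter.Eventually.of_forall fun z => (h t z).trans ?_
    have : ‖t‖ ≤ ‖t₀‖ + 1 := by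
      have h1 : ‖t - t₀‖ < 1 := by simpa [dist_eq_norm] using ht
      have h2 := norm_add_le t₀ (t - t₀)
      rw [add_sub_cancel] at h2
      linarith
    gcongr
  · exact (hint.const_mul _).const_mul _
  · exact Filter.Eventually.of_forall fun z =>
      (hc.comp (by fun_prop : Continuous fun t : E => (t, z))).continuousAt

/-- Fubini: the integrand grows at most polynomially in `t`, which the Schwartz function `g`
absorbs. -/
theorem integral_tfKernel_mul_eq (hF : Continuous F) (hint : Integrable fun z : E × E =>
    ((1 + ‖z.1‖) ^ (Module.finrank ℝ E + 1))⁻¹ * ‖F z‖) (g : 𝓢(E, ℂ)) :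
    ∫ z : E × E, tfKernel g γ z.1 z.2 * F z = ∫ t, g t * stftInverse γ F t := by
  obtain ⟨A, hA, h⟩ := exists_stftInverse_integrand_le γ F
  have hc := continuous_stftInverse_integrand (γ := γ) hF
  have hg : Integrable fun t => (1 + ‖t‖) ^ (Module.finrank ℝ E + 1) * ‖g t‖ := by
    refine ((integrable_one_add_norm_pow_inv (E := E)).const_mul
      (2 ^ (Module.finrank ℝ E + 1 + (Module.finrank ℝ E + 1)) *
        schwartzSup (Module.finrank ℝ E + 1 + (Module.finrank ℝ E + 1), 0) g)).mono' ?_ ?_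
    · have := g.continuous
      exact (by fun_prop : Continuous fun t =>
        (1 + ‖t‖) ^ (Module.finrank ℝ E + 1) * ‖g t‖).aestronglyMeasurable
    · refine Filter.Eventually.of_forall fun t => ?_
      rw [Real.norm_of_nonneg (by positivity), ← div_eq_mul_inv, le_div_iff₀ (by positivity)]
      have := norm_le_schwartzSup (Module.finrank ℝ E + 1 + (Module.finrank ℝ E + 1)) g t
      rw [pow_add] at this
      linarith
  have hi : Integrable (Function.uncurry fun (z : E × E) (t : E) =>
      g t * ((𝐞 (inner ℝ t z.2) : ℂ) * γ (t - z.1) * F z)) := by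
    have hmp := ((hint.mul_prod hg).const_mul A)
    refine hmp.mono' ?_ (Filter.Eventually.of_forall fun w => ?_)
    · have h1 := g.continuous
      exact ((h1.comp continuous_snd).mul (hc.comp (by fun_prop :
        Continuous fun w : (E × E) × E => (w.2, w.1)))).aestronglyMeasurable
    · rw [Function.uncurry, norm_mul]
      calc _ ≤ ‖g w.2‖ * _ := mul_le_mul_of_nonneg_left (h w.2 w.1) (norm_nonneg _)
        _ = _ := by ring
  have h1 : ∀ z : E × E, tfKernel g γ z.1 z.2 * F z =
      ∫ t, g t * ((𝐞 (inner ℝ t z.2) : ℂ) * γ (t - z.1) * F z) := fun z => by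
    rw [tfKernel, SchwartzMap.fourierInv_coe, Real.fourierInv_eq, ← integral_mul_const]
    congr 1
    ext t
    simp only [schwartzMul_apply, SchwartzMap.compSubConstCLM_apply, Circle.smul_def, smul_eq_mul]
    ring
  simp_rw [h1]
  rw [integral_integral_swap hi]
  congr 1
  ext t
  rw [stftInverse, integral_const_mul]

end inverse

/-- Functionals with finite norm are continuous functions, bounded by their norm. -/
theorem exists_represents {p s : ℝ} (hp : 1 ≤ p) (hs : 0 ≤ s) (h : 𝓢(E, ℂ)) (hh : h ≠ 0) :
    ∃ C : ℝ≥0∞, C ≠ ∞ ∧ ∀ L : 𝓢(E, ℂ) →L[ℂ] ℂ, stftNorm h p s L < ∞ →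
      ∃ u, Represents L u ∧ ∀ t, ‖u t‖ₑ ≤ C * stftNorm h p s L := by
  have hp0 : 0 < p := zero_lt_one.trans_le hp
  set γ := schwartzConj h with hγ
  set c := ∫ t, γ t * h t with hc_def
  have hc : c ≠ 0 := integral_conj_mul_ne_zero h hh
  set D := Module.finrank ℝ E + 1 with hD
  obtain ⟨A, hA, hAle⟩ := norm_le_decay γ D
  set M := (∫⁻ y : E, decayWeight D y) ^ ((p - 1) / p)
  have hM : M ≠ ∞ :=
    ENNReal.rpow_ne_top_of_nonneg (div_nonneg (by linarith) hp0.le) lintegral_decayWeight_ne_top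
  refine ⟨‖c⁻¹‖ₑ * (ENNReal.ofReal A * M), ENNReal.mul_ne_top enorm_ne_top
    (ENNReal.mul_ne_top ENNReal.ofReal_ne_top hM), fun L hL => ?_⟩
  set F : E × E → ℂ := fun z => L (tfShift z.1 z.2 h) with hF_def
  have hF : Continuous F := L.continuous.comp (continuous_tfShift h)
  have hFm : Measurable (Function.uncurry fun x ξ : E => ‖F (x, ξ)‖ₑ) := hF.enorm.measurable
  have hbound : ∀ t : E, ∫⁻ z : E × E, decayWeight D (t - z.1) * ‖F z‖ₑ ≤
      M * stftNorm h p s L := fun t => lintegral_decayWeight_translate_le hp hs hFm t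
  have hint : Integrable fun z : E × E => ((1 + ‖z.1‖) ^ D)⁻¹ * ‖F z‖ := by
    have hcont : Continuous fun z : E × E => ((1 + ‖z.1‖) ^ D)⁻¹ * ‖F z‖ :=
      (Continuous.inv₀ (by fun_prop) fun z => by positivity).mul hF.norm
    refine ⟨hcont.aestronglyMeasurable, ?_⟩
    have := (hbound 0).trans_lt (ENNReal.mul_lt_top hM.lt_top hL)
    refine lt_of_le_of_lt (lintegral_mono fun z => ?_) this
    rw [decayWeight, zero_sub, norm_neg, enorm_mul, enorm_norm,
      Real.enorm_eq_ofReal (by positivity)]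
  have hub : ∀ t, ‖c⁻¹ * stftInverse γ F t‖ₑ ≤
      ‖c⁻¹‖ₑ * (ENNReal.ofReal A * M) * stftNorm h p s L := fun t => by
    rw [enorm_mul, mul_assoc, mul_assoc]
    gcongr
    refine (enorm_integral_le_lintegral_enorm _).trans ?_
    refine le_trans ?_ (mul_le_mul_right (hbound t) (ENNReal.ofReal A))
    rw [← lintegral_const_mul' _ _ ENNReal.ofReal_ne_top]
    refine lintegral_mono fun z => ?_
    rw [enorm_mul, enorm_mul, ← mul_assoc, decayWeight, ← ENNReal.ofReal_mul hA]
    have h1 : ‖((𝐞 (inner ℝ t z.2) : Circle) : ℂ)‖ₑ = 1 := by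
      rw [← ofReal_norm, Circle.norm_coe]; simp
    rw [h1, one_mul]
    gcongr
    rw [← ofReal_norm]
    exact ENNReal.ofReal_le_ofReal (hAle _)
  have hcu : Continuous fun t => c⁻¹ * stftInverse γ F t :=
    continuous_const.mul (continuous_stftInverse hF hint)
  refine ⟨fun t => c⁻¹ * stftInverse γ F t, ⟨hcu, fun g => ⟨?_, ?_⟩⟩, hub⟩
  · refine g.integrable.mul_bdd (c := (‖c⁻¹‖ₑ * (ENNReal.ofReal A * M) *
      stftNorm h p s L).toReal) hcu.aestronglyMeasurable (Filter.Eventually.of_forall fun t => ?_)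
    rw [← toReal_enorm]
    refine ENNReal.toReal_mono ?_ (hub t)
    exact ENNReal.mul_ne_top (ENNReal.mul_ne_top enorm_ne_top
      (ENNReal.mul_ne_top ENNReal.ofReal_ne_top hM)) hL.ne
  -- The reproducing formula evaluates `c * L g` as the pairing of `g` with the inversion integral;
  -- dividing by `c` identifies the representative.
  · have key := integral_tfKernel_mul L g γ h
    rw [← hc_def] at key
    have h2 : (fun t => g t * (c⁻¹ * stftInverse γ F t)) =
      fun t => c⁻¹ * (g t * stftInverse γ F t) := by ext t; ring
    rw [h2, integral_const_mul, ← integral_tfKernel_mul_eq hF hint g, ← key, ← mul_assoc,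
      inv_mul_cancel₀ hc, one_mul]

end

/-! ### Products and the convolution theorem. -/

section

variable {E : Type*} [NormedAddCommGroup E] [InnerProductSpace ℝ E] [FiniteDimensional ℝ E]
  [MeasurableSpace E] [BorelSpace E]

/-- Fubini on the inversion integral of `a`. Only `A` and `b` need be integrable, so no
integrability of `a` enters. -/
theorem fourier_mul_eq_integral {a A b : E → ℂ} (hA : Integrable A) (hb : Integrable b)
    (ha : ∀ t, a t = 𝓕⁻ A t) (ξ : E) :
    𝓕 (fun t => a t * b t) ξ = ∫ η, A η * 𝓕 b (ξ - η) := by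
  have hi : Integrable (Function.uncurry fun t η : E =>
      (𝐞 (-inner ℝ t (ξ - η)) : ℂ) * (b t * A η)) := by
    have h1 : Continuous fun z : E × E => (𝐞 (-inner ℝ z.1 (ξ - z.2)) : ℂ) :=
      continuous_subtype_val.comp (Real.continuous_fourierChar.comp
        (by fun_prop : Continuous fun z : E × E => -inner ℝ z.1 (ξ - z.2)))
    refine (hb.mul_prod hA).bdd_mul (c := 1) h1.aestronglyMeasurable
      (Filter.Eventually.of_forall fun z => ?_)
    rw [Circle.norm_coe]
  have h1 : ∀ t, 𝐞 (-inner ℝ t ξ) • (a t * b t) =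
      ∫ η, (𝐞 (-inner ℝ t (ξ - η)) : ℂ) * (b t * A η) := fun t => by
    rw [ha, Real.fourierInv_eq, Circle.smul_def, smul_eq_mul, ← integral_mul_const,
      ← integral_const_mul]
    congr 1
    ext η
    rw [Circle.smul_def, smul_eq_mul, inner_sub_right, neg_sub, sub_eq_add_neg,
      AddChar.map_add_eq_mul, Circle.coe_mul, real_inner_comm η t]
    ring
  rw [Real.fourier_eq]
  simp_rw [h1]
  rw [integral_integral_swap hi]
  congr 1
  ext η
  rw [Real.fourier_eq, ← integral_const_mul]
  congr 1
  ext t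
  rw [Circle.smul_def, smul_eq_mul]
  ring

theorem Represents.integrable_mul {L : 𝓢(E, ℂ) →L[ℂ] ℂ} {u : E → ℂ} (hu : Represents L u)
    (h : 𝓢(E, ℂ)) (x : E) : Integrable fun t => h (t - x) * u t :=
  (hu.2 (SchwartzMap.compSubConstCLM ℂ x h)).1

theorem Represents.apply_tfShift {L : 𝓢(E, ℂ) →L[ℂ] ℂ} {u : E → ℂ} (hu : Represents L u)
    (h : 𝓢(E, ℂ)) (x ξ : E) : L (tfShift x ξ h) = 𝓕 (fun t => h (t - x) * u t) ξ := by
  rw [(hu.2 _).2, Real.fourier_eq]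
  congr 1
  ext t
  rw [tfShift_apply, Circle.smul_def, smul_eq_mul, mul_assoc]

theorem continuous_apply_tfShift (L : 𝓢(E, ℂ) →L[ℂ] ℂ) (h : 𝓢(E, ℂ)) (x : E) :
    Continuous fun ξ => L (tfShift x ξ h) := by
  have h1 : Continuous fun z : E × E => L (tfShift z.1 z.2 h) :=
    L.continuous.comp (continuous_tfShift h)
  have h2 := h1.comp (Continuous.prodMk_right x)
  exact h2

theorem exists_represents_of_bounded {u : E → ℂ} (hu : Continuous u) {C : ℝ}
    (hC : ∀ t, ‖u t‖ ≤ C) : ∃ L : 𝓢(E, ℂ) →L[ℂ] ℂ, Represents L u := by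
  have hm : MemLp u ∞ (volume : Measure E) :=
    memLp_top_of_bound hu.aestronglyMeasurable C (Filter.Eventually.of_forall hC)
  let f : 𝓢'(E, ℂ) := Lp.toTemperedDistribution hm.toLp
  let L : 𝓢(E, ℂ) →L[ℂ] ℂ := f
  refine ⟨L, hu, fun g => ⟨g.integrable.mul_bdd hu.aestronglyMeasurable
    (Filter.Eventually.of_forall hC), ?_⟩⟩
  have h1 : L g = ∫ t, g t • (hm.toLp : E → ℂ) t := Lp.toTemperedDistribution_apply _ g
  rw [h1]
  refine integral_congr_ae ?_
  filter_upwards [hm.coeFn_toLp] with t ht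
  rw [ht, smul_eq_mul]

/-- The transform of a Schwartz function is the kernel `tfKernel θ h x (-ξ)`, which decays to every
order in both variables. -/
theorem stftNorm_schwartz_lt_top {p s : ℝ} (hp : 1 ≤ p) (hs : 0 ≤ s) (h θ : 𝓢(E, ℂ))
    {L : 𝓢(E, ℂ) →L[ℂ] ℂ} (hL : Represents L θ) : stftNorm h p s L < ∞ := by
  have hp0 : 0 < p := zero_lt_one.trans_le hp
  set N := Module.finrank ℝ E + 1 + ⌈s⌉₊ with hN
  obtain ⟨C, hC, hle⟩ := enorm_tfKernel_le θ h N
  have h1 : ∀ x ξ : E, L (tfShift x ξ h) = tfKernel θ h x (-ξ) := fun x ξ => by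
    rw [hL.apply_tfShift, tfKernel, SchwartzMap.fourierInv_coe, Real.fourier_eq, Real.fourierInv_eq]
    congr 1
    ext t
    simp [mul_comm]
  have h2 : ∀ x ξ : E, ‖L (tfShift x ξ h)‖ₑ ≤ C * decayWeight N x * decayWeight N ξ := fun x ξ => by
    rw [h1]
    exact (hle x (-ξ)).trans_eq (by simp [decayWeight])
  have h3 : ∫⁻ x : E, decayWeight N x ^ p ≠ ∞ := by
    refine ne_top_of_le_ne_top (lintegral_weight_mul_decayWeight_ne_top (E := E) hs)
      (lintegral_mono fun x => ?_)
    calc decayWeight N x ^ p ≤ decayWeight N x ^ (1 : ℝ) :=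
          ENNReal.rpow_le_rpow_of_exponent_ge (decayWeight_le_one _ _) hp
      _ = decayWeight N x := ENNReal.rpow_one _
      _ ≤ _ := le_mul_of_one_le_left' (one_le_weight hs x)
  have h4 : ∀ ξ : E, (∫⁻ x, (C * decayWeight N x * decayWeight N ξ) ^ p) ^ (1 / p) =
      C * (∫⁻ x : E, decayWeight N x ^ p) ^ (1 / p) * decayWeight N ξ := fun ξ => by
    simp_rw [ENNReal.mul_rpow_of_nonneg _ _ hp0.le]
    rw [lintegral_mul_const' _ _ (ENNReal.rpow_ne_top_of_nonneg hp0.le (decayWeight_ne_top _ _)),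
      lintegral_const_mul' _ _ (ENNReal.rpow_ne_top_of_nonneg hp0.le hC),
      ENNReal.mul_rpow_of_nonneg _ _ (by positivity), ENNReal.mul_rpow_of_nonneg _ _ (by positivity),
      ← ENNReal.rpow_mul, ← ENNReal.rpow_mul, mul_one_div_cancel hp0.ne', ENNReal.rpow_one,
      ENNReal.rpow_one]
  refine lt_of_le_of_lt (mixedNorm_mono hp h2) ?_
  rw [mixedNorm]
  simp_rw [h4, mul_left_comm (weight s _)]
  have h5 : C * (∫⁻ x : E, decayWeight N x ^ p) ^ (1 / p) ≠ ∞ :=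
    ENNReal.mul_ne_top hC (ENNReal.rpow_ne_top_of_nonneg (by positivity) h3)
  rw [lintegral_const_mul' _ _ h5]
  exact ENNReal.mul_lt_top h5.lt_top (lintegral_weight_mul_decayWeight_ne_top hs).lt_top

theorem enorm_integral_mul_le (A : E → ℂ) (f : E → ℂ) : ‖∫ η, A η * f η‖ₑ ≤
    ∫⁻ η, ‖A η‖ₑ * ‖f η‖ₑ :=
  (enorm_integral_le_lintegral_enorm _).trans_eq (by simp_rw [enorm_mul])

theorem integrable_of_lintegral_weight {s : ℝ} (hs : 0 ≤ s) {A : E → ℂ} (hA : Continuous A)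
    (h : ∫⁻ ξ, weight s ξ * ‖A ξ‖ₑ < ∞) : Integrable A :=
  ⟨hA.aestronglyMeasurable, lt_of_le_of_lt
    (lintegral_mono fun ξ => le_mul_of_one_le_left' (one_le_weight hs ξ)) h⟩

theorem schwartzMul_self_ne_zero {h : 𝓢(E, ℂ)} (hh : h ≠ 0) : schwartzMul h h ≠ 0 := by
  obtain ⟨t, ht⟩ : ∃ t, h t ≠ 0 := by
    by_contra! hc
    exact hh (SchwartzMap.ext hc)
  intro h0
  have : h t * h t = 0 := DFunLike.congr_fun h0 t
  exact ht (mul_self_eq_zero.1 this)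

/-- The functionals with finite norm form an algebra under pointwise multiplication. -/
theorem stftNorm_mul_lt_top {p s : ℝ} (hp : 1 ≤ p) (hs : 0 ≤ s) {h : 𝓢(E, ℂ)} (hh : h ≠ 0)
    {L M P : 𝓢(E, ℂ) →L[ℂ] ℂ} {u v : E → ℂ} (hL : Represents L u) (hM : Represents M v)
    (hP : Represents P (u * v)) (hLn : stftNorm h p s L < ∞) (hMn : stftNorm h p s M < ∞) :
    stftNorm h p s P < ∞ := by
  obtain ⟨C₁, hC₁, h₁⟩ := exists_mixedNorm_tfShift_le hp hs h (schwartzMul h h)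
    (schwartzMul_self_ne_zero hh)
  obtain ⟨C₂, hC₂, h₂⟩ := exists_mixedNorm_tfShift_le hp hs h h hh
  obtain ⟨-, B, hBm, hB, hBw⟩ := h₂ M
  have hBw' : ∫⁻ ξ, weight s ξ * B ξ < ∞ := hBw.trans_lt (ENNReal.mul_lt_top hC₂.lt_top hMn)
  have hi : ∀ x, Integrable fun ξ => M (tfShift x ξ h) := fun x =>
    integrable_of_lintegral_weight hs (continuous_apply_tfShift M h x)
      ((lintegral_mono fun ξ => mul_le_mul_right (hB x ξ) _).trans_lt hBw')
  -- With the window `h²`, each factor receives its own copy of `h`, so at fixed `x` the transform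
  -- of the product is the frequency convolution of the two transforms. One of these is then
  -- dominated by `B`, uniformly in `x`.
  have key : ∀ x ξ, P (tfShift x ξ (schwartzMul h h)) =
      ∫ η, M (tfShift x η h) * L (tfShift x (ξ - η) h) := fun x ξ => by
    have hcont : Continuous fun t => h (t - x) * v t :=
      (h.continuous.comp (by fun_prop)).mul hM.1
    have hF : 𝓕 (fun t => h (t - x) * v t) = fun ξ => M (tfShift x ξ h) := by
      ext ξ; rw [hM.apply_tfShift]
    have hinv := hcont.fourierInv_fourier_eq (hM.integrable_mul h x) (by rw [hF]; exact hi x)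
    have h3 := fourier_mul_eq_integral (hi x) (hL.integrable_mul h x)
      (a := fun t => h (t - x) * v t) (fun t => by rw [← hF, hinv]) ξ
    rw [hP.apply_tfShift]
    simp_rw [hL.apply_tfShift]
    rw [← h3]
    refine congrArg (fun f : E → ℂ => 𝓕 f ξ) (funext fun t => ?_)
    simp only [schwartzMul_apply, Pi.mul_apply]
    ring
  have h4 : stftNorm (schwartzMul h h) p s P ≤ ENNReal.ofReal (2 ^ (s / 2)) *
      (∫⁻ η, weight s η * B η) * stftNorm h p s L := by
    refine mixedNorm_le_of_le_conv hp hs (measurable_enorm_apply_tfShift L h) hBm fun x ξ => ?_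
    rw [key]
    refine (enorm_integral_mul_le _ _).trans (lintegral_mono fun η => ?_)
    gcongr
    exact hB x η
  refine (h₁ P).1.trans_lt (ENNReal.mul_lt_top hC₁.lt_top (h4.trans_lt ?_))
  exact ENNReal.mul_lt_top (ENNReal.mul_lt_top ENNReal.ofReal_lt_top hBw') hLn

/-- Multiplication by a Schwartz function maps weighted Fourier-`L¹` functions to functionals of
finite norm. -/
theorem stftNorm_schwartz_mul_le {p s : ℝ} (hp : 1 ≤ p) (hs : 0 ≤ s) {h θ : 𝓢(E, ℂ)}
    {P Θ : 𝓢(E, ℂ) →L[ℂ] ℂ} {q : E → ℂ} (hΘ : Represents Θ θ)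
    (hP : Represents P fun t => q t * θ t) (hq : Continuous q) (hqi : Integrable q)
    (hQ : Integrable (𝓕 q)) :
    stftNorm h p s P ≤ ENNReal.ofReal (2 ^ (s / 2)) *
      (∫⁻ η, weight s η * ‖𝓕 q η‖ₑ) * stftNorm h p s Θ := by
  have hQm : Continuous (𝓕 q) := VectorFourier.fourierIntegral_continuous Real.continuous_fourierChar
    (innerSL ℝ).continuous₂ hqi
  refine mixedNorm_le_of_le_conv hp hs (measurable_enorm_apply_tfShift Θ h)
    hQm.enorm.measurable fun x ξ => ?_
  have hinv := hq.fourierInv_fourier_eq hqi hQ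
  have h3 := fourier_mul_eq_integral hQ (hΘ.integrable_mul h x) (a := q)
    (fun t => by rw [hinv]) ξ
  have h4 : P (tfShift x ξ h) = ∫ η, 𝓕 q η * Θ (tfShift x (ξ - η) h) := by
    rw [hP.apply_tfShift]
    simp_rw [hΘ.apply_tfShift]
    rw [← h3]
    refine congrArg (fun f : E → ℂ => 𝓕 f ξ) (funext fun t => ?_)
    ring
  rw [h4]
  exact enorm_integral_mul_le _ _

end

/-! ### The modulus of continuity of dilated bumps. -/

section

variable {E : Type*} [NormedAddCommGroup E] [InnerProductSpace ℝ E] [FiniteDimensional ℝ E]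
  [MeasurableSpace E] [BorelSpace E]

theorem lintegral_comp_smul_eq (f : E → ℝ≥0∞) {r : ℝ} (hr : 0 < r) :
    ∫⁻ x, f (r • x) = ENNReal.ofReal ((r ^ Module.finrank ℝ E)⁻¹) * ∫⁻ x, f x := by
  have h1 := (Homeomorph.smulOfNeZero r hr.ne' (α := E)).measurableEmbedding.lintegral_map
    (μ := volume) f
  have h2 : ⇑(Homeomorph.smulOfNeZero r hr.ne' (α := E)) = (r • ·) := rfl
  rw [h2] at h1
  rw [← h1, Measure.map_addHaar_smul volume hr.ne', lintegral_smul_measure,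
    abs_of_pos (by positivity), smul_eq_mul]

theorem weight_smul_le {s : ℝ} (hs : 0 ≤ s) {k : ℝ} (hk : 1 ≤ k) (ζ : E) :
    weight s (k • ζ) ≤ ENNReal.ofReal (k ^ s) * weight s ζ := by
  have hk0 : 0 ≤ k := by linarith
  rw [weight, weight, ← ENNReal.ofReal_mul (by positivity)]
  refine ENNReal.ofReal_le_ofReal ?_
  rw [smul_comm, norm_smul k, Real.norm_of_nonneg hk0]
  have h1 : k ^ s = (k ^ 2) ^ (s / 2) := by
    rw [← Real.rpow_natCast, ← Real.rpow_mul hk0]; congr 1; push_cast; ring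
  rw [h1, ← Real.mul_rpow (by positivity) (by positivity)]
  refine Real.rpow_le_rpow (by positivity) ?_ (by positivity)
  nlinarith [sq_nonneg ‖(2 * Real.pi) • ζ‖]

theorem ofReal_norm_rpow_le_weight {s : ℝ} (hs : 0 ≤ s) (η : E) :
    ENNReal.ofReal (‖η‖ ^ s) ≤ weight s η := by
  rw [weight]
  refine ENNReal.ofReal_le_ofReal ?_
  have h1 : ‖η‖ ^ s = (‖η‖ ^ 2) ^ (s / 2) := by
    rw [← Real.rpow_natCast, ← Real.rpow_mul (norm_nonneg _)]; congr 1; push_cast; ring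
  rw [h1]
  refine Real.rpow_le_rpow (by positivity) ?_ (by positivity)
  rw [norm_smul, Real.norm_of_nonneg (by positivity), mul_pow]
  have hpi := Real.pi_gt_three
  have h2 : (1 : ℝ) ≤ (2 * Real.pi) ^ 2 := by nlinarith
  nlinarith [mul_le_mul_of_nonneg_right h2 (sq_nonneg ‖η‖)]

/-- When `k ≤ ‖η‖`, one has `‖k • ζ + η‖ ≤ ‖η‖ * (‖ζ‖ + 1)`; no power of `k` is lost, as uniform
domination in `k` requires. -/
theorem weight_smul_add_le {s : ℝ} (hs : 0 ≤ s) {k : ℝ} (hk : 0 ≤ k) {ζ η : E} (hη : k ≤ ‖η‖) :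
    weight s (k • ζ + η) ≤ ENNReal.ofReal (2 ^ (s / 2)) * (weight s η * weight s ζ) := by
  rw [weight, weight, weight, ← ENNReal.ofReal_mul (by positivity),
    ← ENNReal.ofReal_mul (by positivity), ← Real.mul_rpow (by positivity) (by positivity),
    ← Real.mul_rpow (by positivity) (by positivity)]
  refine ENNReal.ofReal_le_ofReal (Real.rpow_le_rpow (by positivity) ?_ (by positivity))
  have hpi := Real.pi_gt_three
  have h1 : ‖k • ζ + η‖ ≤ ‖η‖ * (‖ζ‖ + 1) := by
    refine (norm_add_le _ _).trans ?_
    rw [norm_smul, Real.norm_of_nonneg hk]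
    nlinarith [mul_le_mul_of_nonneg_right hη (norm_nonneg ζ)]
  simp only [norm_smul, Real.norm_of_nonneg (by positivity : (0 : ℝ) ≤ 2 * Real.pi), mul_pow]
  have h2 : ‖k • ζ + η‖ ^ 2 ≤ ‖η‖ ^ 2 * (2 * (1 + ‖ζ‖ ^ 2)) := by
    calc ‖k • ζ + η‖ ^ 2 ≤ (‖η‖ * (‖ζ‖ + 1)) ^ 2 := by gcongr
      _ = ‖η‖ ^ 2 * (‖ζ‖ + 1) ^ 2 := by ring
      _ ≤ ‖η‖ ^ 2 * (2 * (1 + ‖ζ‖ ^ 2)) := by gcongr; nlinarith [sq_nonneg (‖ζ‖ - 1)]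
  set c := 2 ^ 2 * Real.pi ^ 2 with hc
  have hc1 : 1 ≤ c := by nlinarith
  have h3 : c * ‖k • ζ + η‖ ^ 2 ≤ c * (‖η‖ ^ 2 * (2 * (1 + ‖ζ‖ ^ 2))) := by gcongr
  have h4 : ‖ζ‖ ^ 2 ≤ c * ‖ζ‖ ^ 2 := le_mul_of_one_le_left (by positivity) hc1
  have h5 : 0 ≤ c * ‖η‖ ^ 2 := by positivity
  nlinarith [mul_le_mul_of_nonneg_left h4 h5]

/-- The weighted `L¹` modulus of continuity of the dilates of `X`. -/
noncomputable def dilationModulus (s : ℝ) (X : E → ℂ) (k : ℝ) (η : E) : ℝ≥0∞ :=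
  ∫⁻ ζ, weight s (k • ζ) * ‖X (ζ - k⁻¹ • η) - X ζ‖ₑ

theorem measurable_dilationModulus (s : ℝ) {X : E → ℂ} (hX : Continuous X) (k : ℝ) :
    Measurable (dilationModulus s X k) := by
  refine Measurable.lintegral_prod_right' (f := fun z : E × E =>
    weight s (k • z.2) * ‖X (z.2 - k⁻¹ • z.1) - X z.2‖ₑ) ?_
  have h1 : Continuous fun z : E × E => X (z.2 - k⁻¹ • z.1) - X z.2 := by fun_prop
  exact ((measurable_weight s).comp (by fun_prop)).mul h1.enorm.measurable

theorem exists_enorm_sub_le (X : 𝓢(E, ℂ)) (N : ℕ) : ∃ C : ℝ, 0 ≤ C ∧ ∀ h : E, ‖h‖ ≤ 1 → ∀ ζ,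
    ‖X (ζ - h) - X ζ‖ₑ ≤ ENNReal.ofReal (C * ‖h‖) * decayWeight N ζ := by
  refine ⟨2 ^ N * (4 ^ N * schwartzSup (N, 0 + 1) X), by positivity, fun h hh ζ => ?_⟩
  have h1 := norm_le_schwartzSup N (SchwartzMap.compSubConstCLM ℂ h X - X) ζ
  have h2 := schwartzSup_compSubConst_sub_le (N, 0) h X hh
  have h3 : (SchwartzMap.compSubConstCLM ℂ h X - X) ζ = X (ζ - h) - X ζ := rfl
  rw [h3] at h1
  rw [decayWeight, ← ENNReal.ofReal_mul (by positivity), ← ofReal_norm]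
  refine ENNReal.ofReal_le_ofReal ?_
  rw [← div_eq_mul_inv, le_div_iff₀ (by positivity), mul_comm]
  refine h1.trans ?_
  rw [mul_assoc]
  gcongr

/-- The dilated weight costs `k ^ s`, while the Lipschitz bound for a shift by `k⁻¹ • η` gains `k⁻¹
* ‖η‖`. The product tends to 0 in `k` precisely when `s < 1`, for `η ≠ 0`. -/
theorem exists_dilationModulus_le {s : ℝ} (hs : 0 ≤ s) (X : 𝓢(E, ℂ)) :
    ∃ C : ℝ≥0∞, C ≠ ∞ ∧ ∀ (k : ℝ) (η : E), 1 ≤ k → ‖η‖ ≤ k →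
      dilationModulus s X k η ≤ C * ENNReal.ofReal (k ^ (s - 1) * ‖η‖) := by
  set N := Module.finrank ℝ E + 1 + ⌈s⌉₊ with hN
  obtain ⟨C, hC, hle⟩ := exists_enorm_sub_le X N
  have hI : ∫⁻ ζ : E, weight s ζ * decayWeight N ζ ≠ ∞ := lintegral_weight_mul_decayWeight_ne_top hs
  refine ⟨ENNReal.ofReal C * ∫⁻ ζ : E, weight s ζ * decayWeight N ζ,
    ENNReal.mul_ne_top ENNReal.ofReal_ne_top hI, fun k η hk hη => ?_⟩
  have hk0 : 0 < k := by linarith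
  have hn : ‖k⁻¹ • η‖ = k⁻¹ * ‖η‖ := by rw [norm_smul, Real.norm_of_nonneg (by positivity)]
  have hη' : ‖k⁻¹ • η‖ ≤ 1 := by
    rw [hn, inv_mul_le_iff₀ hk0]; linarith
  calc dilationModulus s X k η
      ≤ ∫⁻ ζ, ENNReal.ofReal (k ^ s) * ENNReal.ofReal (C * ‖k⁻¹ • η‖) *
          (weight s ζ * decayWeight N ζ) := by
        refine lintegral_mono fun ζ => ?_
        calc _ ≤ (ENNReal.ofReal (k ^ s) * weight s ζ) *
              (ENNReal.ofReal (C * ‖k⁻¹ • η‖) * decayWeight N ζ) := by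
              gcongr
              · exact weight_smul_le hs hk ζ
              · exact hle _ hη' ζ
          _ = _ := by ring
    _ = ENNReal.ofReal (k ^ s) * ENNReal.ofReal (C * ‖k⁻¹ • η‖) *
          ∫⁻ ζ : E, weight s ζ * decayWeight N ζ :=
        lintegral_const_mul' _ _ (ENNReal.mul_ne_top ENNReal.ofReal_ne_top ENNReal.ofReal_ne_top)
    _ = _ := by
        rw [hn, Real.rpow_sub_one hk0.ne', ← ENNReal.ofReal_mul (by positivity), mul_right_comm,
          ← ENNReal.ofReal_mul hC]
        congr 2
        field_simp

/-- For `‖η‖ ≤ k`, a negative exponent gives `k ^ (s - 1) * ‖η‖ ≤ ‖η‖ ^ s`. For `‖η‖ > k` there is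
no smoothness gain, and the two terms of the difference are bounded separately. -/
theorem exists_dilationModulus_le_weight {s : ℝ} (hs : 0 ≤ s) (hs1 : s < 1) (X : 𝓢(E, ℂ)) :
    ∃ C : ℝ≥0∞, C ≠ ∞ ∧ ∀ (k : ℝ) (η : E), 1 ≤ k →
      dilationModulus s X k η ≤ C * weight s η := by
  obtain ⟨C₁, hC₁, h₁⟩ := exists_dilationModulus_le hs X
  have hX : Measurable fun ζ => ‖X ζ‖ₑ := X.continuous.enorm.measurable
  set I := ∫⁻ ζ, weight s ζ * ‖X ζ‖ₑ with hI_def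
  have hI : I ≠ ∞ := by
    obtain ⟨A, hA, hle⟩ := norm_le_decay X (Module.finrank ℝ E + 1 + ⌈s⌉₊)
    have h2 : ∀ ζ, weight s ζ * ‖X ζ‖ₑ ≤ ENNReal.ofReal A *
        (weight s ζ * decayWeight (Module.finrank ℝ E + 1 + ⌈s⌉₊) ζ) := fun ζ => by
      rw [mul_left_comm, decayWeight, ← ENNReal.ofReal_mul hA, ← ofReal_norm]
      gcongr
      exact hle ζ
    refine ne_top_of_le_ne_top ?_ (lintegral_mono h2)
    rw [lintegral_const_mul' _ _ ENNReal.ofReal_ne_top]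
    exact ENNReal.mul_ne_top ENNReal.ofReal_ne_top (lintegral_weight_mul_decayWeight_ne_top hs)
  set c := ENNReal.ofReal (2 ^ (s / 2)) with hc
  refine ⟨max C₁ ((c + 1) * I), ?_, fun k η hk => ?_⟩
  · exact (max_lt hC₁.lt_top (ENNReal.mul_lt_top (by simp [hc]) hI.lt_top)).ne
  have hk0 : 0 < k := by linarith
  rcases le_or_gt ‖η‖ k with hη | hη
  · calc _ ≤ C₁ * ENNReal.ofReal (k ^ (s - 1) * ‖η‖) := h₁ k η hk hη
      _ ≤ max C₁ ((c + 1) * I) * weight s η := by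
        refine mul_le_mul' (le_max_left _ _) (le_trans (ENNReal.ofReal_le_ofReal ?_)
          (ofReal_norm_rpow_le_weight hs η))
        rcases (norm_nonneg η).eq_or_lt with h0 | h0
        · rw [← h0, mul_zero]; positivity
        · calc k ^ (s - 1) * ‖η‖ ≤ ‖η‖ ^ (s - 1) * ‖η‖ := by
                gcongr ?_ * _
                exact Real.rpow_le_rpow_of_nonpos h0 hη (by linarith)
            _ = ‖η‖ ^ s := by rw [Real.rpow_sub_one h0.ne']; field_simp
  · have h3 : ∫⁻ ζ, weight s (k • ζ) * ‖X (ζ - k⁻¹ • η)‖ₑ ≤ c * weight s η * I := by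
      rw [← lintegral_add_right_eq_self _ (k⁻¹ • η), hI_def,
        ← lintegral_const_mul' _ _ (ENNReal.mul_ne_top ENNReal.ofReal_ne_top (weight_ne_top _ _))]
      refine lintegral_mono fun ζ => ?_
      simp only [add_sub_cancel_right, smul_add, smul_inv_smul₀ hk0.ne']
      calc _ ≤ (c * (weight s η * weight s ζ)) * ‖X ζ‖ₑ := by
            gcongr; exact weight_smul_add_le hs hk0.le hη.le
        _ = _ := by ring
    have h4 : ∫⁻ ζ, weight s (k • ζ) * ‖X ζ‖ₑ ≤ weight s η * I := by
      rw [hI_def, ← lintegral_const_mul' _ _ (weight_ne_top _ _)]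
      refine lintegral_mono fun ζ => ?_
      rw [← mul_assoc]
      gcongr
      refine (weight_smul_le hs hk ζ).trans ?_
      gcongr
      refine le_trans (ENNReal.ofReal_le_ofReal ?_) (ofReal_norm_rpow_le_weight hs η)
      gcongr
    have hm : Measurable fun ζ : E => weight s (k • ζ) * ‖X ζ‖ₑ :=
      ((measurable_weight s).comp (by fun_prop)).mul hX
    calc dilationModulus s X k η
        ≤ ∫⁻ ζ, (weight s (k • ζ) * ‖X (ζ - k⁻¹ • η)‖ₑ + weight s (k • ζ) * ‖X ζ‖ₑ) := by
          refine lintegral_mono fun ζ => ?_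
          rw [← mul_add]
          gcongr
          exact enorm_sub_le
      _ = (∫⁻ ζ, weight s (k • ζ) * ‖X (ζ - k⁻¹ • η)‖ₑ) + ∫⁻ ζ, weight s (k • ζ) * ‖X ζ‖ₑ :=
          lintegral_add_right _ hm
      _ ≤ c * weight s η * I + weight s η * I := add_le_add h3 h4
      _ = (c + 1) * I * weight s η := by ring
      _ ≤ _ := by gcongr; exact le_max_right _ _

/-- Dominated convergence: the estimate with `k ^ (s - 1)` gives the pointwise limit, the bound by
the weight gives the majorant. -/
theorem tendsto_lintegral_mul_dilationModulus {s : ℝ} (hs : 0 ≤ s) (hs1 : s < 1) (X : 𝓢(E, ℂ))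
    {g : E → ℝ≥0∞} (hg : Measurable g) (hgi : ∫⁻ η, weight s η * g η ≠ ∞) :
    Filter.Tendsto (fun j : ℕ => ∫⁻ η, g η * dilationModulus s X (j + 1) η)
      Filter.atTop (𝓝 0) := by
  obtain ⟨C₁, hC₁, h₁⟩ := exists_dilationModulus_le hs X
  obtain ⟨C₂, hC₂, h₂⟩ := exists_dilationModulus_le_weight hs hs1 X
  have hj : ∀ j : ℕ, (1 : ℝ) ≤ j + 1 := fun j => by linarith [(Nat.cast_nonneg j : (0 : ℝ) ≤ j)]
  have hlim : Filter.Tendsto (fun j : ℕ => ((j : ℝ) + 1)) Filter.atTop Filter.atTop :=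
    Filter.tendsto_atTop_add_const_right _ _ tendsto_natCast_atTop_atTop
  have hae : ∀ᵐ η : E, g η < ∞ := by
    filter_upwards [ae_lt_top ((measurable_weight s).mul hg) hgi] with η hη
    exact lt_of_le_of_lt (le_mul_of_one_le_left' (one_le_weight hs η)) hη
  have h0 : (0 : ℝ≥0∞) = ∫⁻ _ : E, 0 := by simp
  rw [h0]
  refine tendsto_lintegral_of_dominated_convergence (fun η => C₂ * (weight s η * g η))
    (fun j => hg.mul (measurable_dilationModulus s X.continuous _)) (fun j => ?_) ?_ ?_
  · refine Filter.Eventually.of_forall fun η => ?_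
    calc _ ≤ g η * (C₂ * weight s η) := mul_le_mul_right (h₂ _ _ (hj j)) _
      _ = _ := by ring
  · rw [lintegral_const_mul' _ _ hC₂]
    exact ENNReal.mul_ne_top hC₂ hgi
  · filter_upwards [hae] with η hη
    have e1 : Filter.Tendsto (fun j : ℕ => ((j : ℝ) + 1) ^ (s - 1) * ‖η‖) Filter.atTop (𝓝 0) := by
      have := ((tendsto_rpow_neg_atTop (y := 1 - s) (by linarith)).comp hlim).mul_const ‖η‖
      simpa [Function.comp_def] using this
    have e2 : Filter.Tendsto (fun j : ℕ => g η * (C₁ *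
        ENNReal.ofReal (((j : ℝ) + 1) ^ (s - 1) * ‖η‖))) Filter.atTop (𝓝 0) := by
      have := ENNReal.Tendsto.const_mul (a := g η) (ENNReal.Tendsto.const_mul (a := C₁)
        (ENNReal.tendsto_ofReal e1) (Or.inr hC₁)) (Or.inr hη.ne)
      simpa using this
    refine tendsto_of_tendsto_of_tendsto_of_le_of_le' tendsto_const_nhds e2
      (Filter.Eventually.of_forall fun j => zero_le) ?_
    filter_upwards [hlim.eventually_ge_atTop ‖η‖] with j hj'
    gcongr
    exact h₁ _ _ (hj j) hj'

end

/-! ### Localisation at a zero. -/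

section

variable {E : Type*} [NormedAddCommGroup E] [InnerProductSpace ℝ E] [FiniteDimensional ℝ E]
  [MeasurableSpace E] [BorelSpace E]

theorem fourier_comp_smul_sub (f : E → ℂ) {k : ℝ} (hk : 0 < k) (x₀ ξ : E) :
    𝓕 (fun t => f (k • (t - x₀))) ξ =
      (𝐞 (-inner ℝ x₀ ξ) : ℂ) * (((k ^ Module.finrank ℝ E)⁻¹ : ℝ) * 𝓕 f (k⁻¹ • ξ)) := by
  rw [Real.fourier_eq, Real.fourier_eq, ← integral_add_right_eq_self _ x₀]
  have h1 := Measure.integral_comp_smul_of_nonneg (volume : Measure E)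
    (fun y => 𝐞 (-inner ℝ y (k⁻¹ • ξ)) • f y) k (hR := hk.le)
  rw [← Complex.real_smul, ← h1, ← integral_const_mul]
  congr 1
  ext t
  rw [add_sub_cancel_right, Circle.smul_def, Circle.smul_def, smul_eq_mul, smul_eq_mul,
    inner_smul_left, inner_smul_right, inner_add_left, neg_add, AddChar.map_add_eq_mul,
    Circle.coe_mul]
  simp only [conj_trivial]
  rw [mul_inv_cancel_left₀ hk.ne']
  ring

/-- This is where `a x₀ = 0` enters. It turns the convolution of `A` with the transform of the
dilated bump into an integral against differences of that transform, up to unimodular phases. -/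
theorem lintegral_weight_fourier_mul_le (s : ℝ) {a A : E → ℂ} (hA : Integrable A)
    (hAc : Continuous A) (ha : ∀ t, a t = 𝓕⁻ A t) {x₀ : E} (h0 : a x₀ = 0) (χ : 𝓢(E, ℂ)) {k : ℝ}
    (hk : 0 < k) (hχ : Integrable fun t => χ (k • (t - x₀))) :
    ∫⁻ ξ, weight s ξ * ‖𝓕 (fun t => a t * χ (k • (t - x₀))) ξ‖ₑ ≤
      ∫⁻ η, ‖A η‖ₑ * dilationModulus s (𝓕 χ : 𝓢(E, ℂ)) k η := by
  obtain ⟨X, hX⟩ : ∃ X : 𝓢(E, ℂ), X = 𝓕 χ := ⟨_, rfl⟩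
  rw [← hX]
  have hXχ : ∀ ξ, 𝓕 (χ : E → ℂ) ξ = X ξ := fun ξ => by rw [hX, SchwartzMap.fourier_coe]
  have hc := X.continuous
  obtain ⟨c, hc_def⟩ : ∃ c : ℝ, c = (k ^ Module.finrank ℝ E)⁻¹ := ⟨_, rfl⟩
  have hcpos : 0 < c := by rw [hc_def]; positivity
  have hker : ∀ ξ, 𝓕 (fun t => χ (k • (t - x₀))) ξ =
      (𝐞 (-inner ℝ x₀ ξ) : ℂ) * (c * X (k⁻¹ • ξ)) := fun ξ => by
    rw [fourier_comp_smul_sub _ hk, hXχ, hc_def]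
  have hzero : ∫ η, (𝐞 (inner ℝ x₀ η) : ℂ) * A η = 0 := by
    rw [← h0, ha, Real.fourierInv_eq]
    congr 1
    ext η
    rw [Circle.smul_def, smul_eq_mul, real_inner_comm]
  have hbound : ∀ ξ, ‖𝓕 (fun t => a t * χ (k • (t - x₀))) ξ‖ₑ ≤
      ∫⁻ η, ‖A η‖ₑ * (ENNReal.ofReal c * ‖X (k⁻¹ • ξ - k⁻¹ • η) - X (k⁻¹ • ξ)‖ₑ) := fun ξ => by
    have hi1 : Integrable fun η => A η * 𝓕 (fun t => χ (k • (t - x₀))) (ξ - η) := by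
      refine hA.mul_bdd (c := ∫ t, ‖χ (k • (t - x₀))‖) ?_ (Filter.Eventually.of_forall fun η => ?_)
      · have : Continuous (𝓕 (fun t => χ (k • (t - x₀)))) :=
          VectorFourier.fourierIntegral_continuous Real.continuous_fourierChar
            (innerSL ℝ).continuous₂ hχ
        exact (this.comp (by fun_prop)).aestronglyMeasurable
      · exact VectorFourier.norm_fourierIntegral_le_integral_norm _ _ _ _ _
    have hi2 : Integrable fun η => (𝐞 (inner ℝ x₀ η) : ℂ) * A η := by
      refine hA.bdd_mul (c := 1) ?_ (Filter.Eventually.of_forall fun η => by rw [Circle.norm_coe])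
      exact (continuous_subtype_val.comp (Real.continuous_fourierChar.comp
        (by fun_prop : Continuous fun η : E => inner ℝ x₀ η))).aestronglyMeasurable
    obtain ⟨b, hb⟩ : ∃ b : ℂ, b = 𝓕 (fun t => χ (k • (t - x₀))) ξ := ⟨_, rfl⟩
    have h1 : 𝓕 (fun t => a t * χ (k • (t - x₀))) ξ =
        ∫ η, A η * (𝓕 (fun t => χ (k • (t - x₀))) (ξ - η) - (𝐞 (inner ℝ x₀ η) : ℂ) * b) := by
      rw [fourier_mul_eq_integral hA hχ ha ξ]
      -- The subtracted term is `a x₀` times the transform of the bump at `ξ`, hence zero.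
      have h2 : ∫ η, (𝐞 (inner ℝ x₀ η) : ℂ) * A η * b = 0 := by
        rw [integral_mul_const, hzero, zero_mul]
      rw [← sub_zero (∫ η, A η * _), ← h2, ← integral_sub hi1 (hi2.mul_const b)]
      congr 1
      ext η
      ring
    rw [h1]
    refine (enorm_integral_mul_le _ _).trans_eq (lintegral_congr fun η => ?_)
    congr 1
    have h3 : 𝓕 (fun t => χ (k • (t - x₀))) (ξ - η) - (𝐞 (inner ℝ x₀ η) : ℂ) * b =
        (𝐞 (-inner ℝ x₀ (ξ - η)) : ℂ) * ((c : ℂ) * (X (k⁻¹ • ξ - k⁻¹ • η) - X (k⁻¹ • ξ))) := by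
      rw [hb, hker, hker, inner_sub_right, neg_sub, sub_eq_add_neg (inner ℝ x₀ η), AddChar.map_add_eq_mul,
        Circle.coe_mul, smul_sub]
      ring
    rw [h3, enorm_mul, enorm_mul, ← ofReal_norm, Circle.norm_coe, ENNReal.ofReal_one, one_mul,
      ← ofReal_norm (c : ℂ), Complex.norm_real, Real.norm_of_nonneg hcpos.le]
  have hm : Measurable (Function.uncurry fun ξ η : E => weight s ξ * (‖A η‖ₑ *
      (ENNReal.ofReal c * ‖X (k⁻¹ • ξ - k⁻¹ • η) - X (k⁻¹ • ξ)‖ₑ))) := by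
    have h1 : Continuous fun z : E × E => X (k⁻¹ • z.1 - k⁻¹ • z.2) - X (k⁻¹ • z.1) := by fun_prop
    have h2 := h1.enorm.measurable
    have h3 : Measurable fun z : E × E => ‖A z.2‖ₑ := hAc.enorm.measurable.comp measurable_snd
    exact ((measurable_weight s).comp measurable_fst).mul (h3.mul (h2.const_mul _))
  calc _ ≤ ∫⁻ ξ, ∫⁻ η, weight s ξ * (‖A η‖ₑ *
        (ENNReal.ofReal c * ‖X (k⁻¹ • ξ - k⁻¹ • η) - X (k⁻¹ • ξ)‖ₑ)) := by
        refine lintegral_mono fun ξ => ?_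
        rw [lintegral_const_mul' _ _ (weight_ne_top _ _)]
        exact mul_le_mul_right (hbound ξ) _
    _ = ∫⁻ η, ∫⁻ ξ, weight s ξ * (‖A η‖ₑ *
        (ENNReal.ofReal c * ‖X (k⁻¹ • ξ - k⁻¹ • η) - X (k⁻¹ • ξ)‖ₑ)) :=
        lintegral_lintegral_swap hm.aemeasurable
    _ = _ := by
        refine lintegral_congr fun η => ?_
        -- Substituting `ξ = k • ζ` produces the Jacobian `k ^ n`, cancelling the factor `c` from
        -- the transform of the dilated bump.
        have h1 := lintegral_comp_smul_eq
          (fun ζ : E => weight s (k • ζ) * ‖X (ζ - k⁻¹ • η) - X ζ‖ₑ) (inv_pos.2 hk)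
        simp only [smul_inv_smul₀ hk.ne'] at h1
        rw [dilationModulus]
        have h2 : ∀ ξ, weight s ξ * (‖A η‖ₑ *
            (ENNReal.ofReal c * ‖X (k⁻¹ • ξ - k⁻¹ • η) - X (k⁻¹ • ξ)‖ₑ)) =
            ‖A η‖ₑ * ENNReal.ofReal c *
              (weight s ξ * ‖X (k⁻¹ • ξ - k⁻¹ • η) - X (k⁻¹ • ξ)‖ₑ) := fun ξ => by ring
        simp_rw [h2]
        rw [lintegral_const_mul' _ _ (ENNReal.mul_ne_top enorm_ne_top ENNReal.ofReal_ne_top), h1,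
          inv_pow, inv_inv, mul_assoc, ← mul_assoc (ENNReal.ofReal c),
          ← ENNReal.ofReal_mul hcpos.le, hc_def, inv_mul_cancel₀ (by positivity),
          ENNReal.ofReal_one, one_mul]

theorem exists_schwartz_bump (x₀ : E) {r R : ℝ} (hr : 0 < r) (hR : r < R) : ∃ χ : 𝓢(E, ℂ),
    (∀ t, ‖t - x₀‖ ≤ r → χ t = 1) ∧ ∀ t, R ≤ ‖t - x₀‖ → χ t = 0 := by
  let b : ContDiffBump x₀ := ⟨r, R, hr, hR⟩
  refine ⟨(b.hasCompactSupport.comp_left Complex.ofReal_zero).toSchwartzMap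
    (Complex.ofRealCLM.contDiff.comp b.contDiff), fun t ht => ?_, fun t ht => ?_⟩
  · have : b t = 1 := b.one_of_mem_closedBall (by rwa [mem_closedBall_iff_norm])
    change ((b t : ℝ) : ℂ) = 1
    rw [this, Complex.ofReal_one]
  · have : b t = 0 := b.zero_of_le_dist (by rwa [dist_eq_norm])
    change ((b t : ℝ) : ℂ) = 0
    rw [this, Complex.ofReal_zero]

/-- A function of finite norm vanishing at `x₀` agrees near `x₀` with functions of arbitrarily
small norm. -/
theorem exists_represents_eventuallyEq_stftNorm_lt {p s : ℝ} (hp : 1 ≤ p) (hs : 0 ≤ s) (hs1 : s < 1)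
    {h : 𝓢(E, ℂ)} (hh : h ≠ 0) {L : 𝓢(E, ℂ) →L[ℂ] ℂ} {u : E → ℂ} (hL : Represents L u)
    (hLn : stftNorm h p s L < ∞) {x₀ : E} (h0 : u x₀ = 0) {ε : ℝ≥0∞} (hε : 0 < ε) :
    ∃ (P : 𝓢(E, ℂ) →L[ℂ] ℂ) (v : E → ℂ), Represents P v ∧ v =ᶠ[𝓝 x₀] u ∧
      stftNorm h p s P < ε := by
  -- `θ` is 1 on the ball of radius 2, outside which `χ (k • (t - x₀))` vanishes for every `k ≥ 1`;
  -- thus one `θ` serves all dilations.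
  obtain ⟨θ, hθ1, -⟩ := exists_schwartz_bump x₀ (by norm_num : (0 : ℝ) < 2)
    (by norm_num : (2 : ℝ) < 3)
  obtain ⟨χ, hχ1, hχ0⟩ := exists_schwartz_bump (0 : E) (by norm_num : (0 : ℝ) < 1)
    (by norm_num : (1 : ℝ) < 2)
  simp only [sub_zero] at hχ1 hχ0
  obtain ⟨C₀, hC₀, h₀⟩ := exists_represents hp hs h hh
  obtain ⟨u', hu', hub⟩ := h₀ L hLn
  obtain rfl := hL.unique hu'
  have hubd : ∀ t, ‖u t‖ ≤ (C₀ * stftNorm h p s L).toReal := fun t => by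
    rw [← toReal_enorm]
    exact ENNReal.toReal_mono (ENNReal.mul_ne_top hC₀ hLn.ne) (hub t)
  -- Using `θ` as window at position 0, the transform of `L` is the Fourier transform of `θ * u`;
  -- the uniform majorant `B` makes it weighted-integrable.
  obtain ⟨C, hC, hCl⟩ := exists_mixedNorm_tfShift_le hp hs θ h hh
  obtain ⟨-, B, hBm, hB, hBw⟩ := hCl L
  obtain ⟨A, hA_def⟩ : ∃ A : E → ℂ, A = fun η => L (tfShift 0 η θ) := ⟨_, rfl⟩
  have hAc : Continuous A := by rw [hA_def]; exact continuous_apply_tfShift L θ 0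
  have hAw : ∫⁻ η, weight s η * ‖A η‖ₑ < ∞ := by
    refine lt_of_le_of_lt (lintegral_mono fun η => ?_)
      (hBw.trans_lt (ENNReal.mul_lt_top hC.lt_top hLn))
    rw [hA_def]
    exact mul_le_mul_right (hB 0 η) _
  have hAi := integrable_of_lintegral_weight hs hAc hAw
  have hai : Integrable fun t => θ t * u t := (hL.2 θ).1
  have hac : Continuous fun t => θ t * u t := θ.continuous.mul hL.1
  have hAF : A = 𝓕 fun t => θ t * u t := by
    ext η
    simp only [hA_def, hL.apply_tfShift, sub_zero]
  have hinv := hac.fourierInv_fourier_eq hai (hAF ▸ hAi)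
  rw [← hAF] at hinv
  obtain ⟨Θ, hΘ⟩ := exists_represents_of_bounded (C := 2 ^ 0 * schwartzSup (0, 0) θ) θ.continuous
    fun t => by simpa using norm_le_schwartzSup 0 θ t
  have hΘn := stftNorm_schwartz_lt_top hp hs h θ hΘ
  have hlim := tendsto_lintegral_mul_dilationModulus hs hs1 (𝓕 χ : 𝓢(E, ℂ)) hAc.enorm.measurable
    hAw.ne
  have hlim2 := ENNReal.Tendsto.const_mul
    (a := ENNReal.ofReal (2 ^ (s / 2)) * stftNorm h p s Θ) hlim
    (Or.inr (ENNReal.mul_ne_top ENNReal.ofReal_ne_top hΘn.ne))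
  rw [mul_zero] at hlim2
  -- Finiteness of the integral is requested separately: the constant in front is not known to be
  -- nonzero, and integrability of `𝓕 q` depends on it.
  obtain ⟨j, hj, hjt⟩ := ((hlim2.eventually (gt_mem_nhds hε)).and
    (hlim.eventually (gt_mem_nhds ENNReal.zero_lt_top))).exists
  obtain ⟨k, hk_def⟩ : ∃ k : ℝ, k = j + 1 := ⟨_, rfl⟩
  rw [← hk_def] at hj hjt
  have hk : 1 ≤ k := by rw [hk_def]; linarith [(Nat.cast_nonneg j : (0 : ℝ) ≤ j)]
  have hk0 : 0 < k := by linarith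
  have hnorm : ∀ t, ‖k • (t - x₀)‖ = k * ‖t - x₀‖ := fun t => by
    rw [norm_smul, Real.norm_of_nonneg hk0.le]
  have hχc : Continuous fun t => χ (k • (t - x₀)) := χ.continuous.comp (by fun_prop)
  have hχi : Integrable fun t => χ (k • (t - x₀)) :=
    (χ.integrable.comp_smul hk0.ne').comp_sub_right x₀
  have hmulθ : ∀ t, χ (k • (t - x₀)) * θ t = χ (k • (t - x₀)) := fun t => by
    rcases le_or_gt ‖t - x₀‖ 2 with ht | ht
    · rw [hθ1 t ht, mul_one]
    · rw [hχ0 _ (by rw [hnorm]; nlinarith), zero_mul]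
  have hle := lintegral_weight_fourier_mul_le s hAi hAc (fun t => (congrFun hinv t).symm)
    (by rw [h0, mul_zero]) χ hk0 hχi
  obtain ⟨q, hq_def⟩ : ∃ q : E → ℂ, q = fun t => θ t * u t * χ (k • (t - x₀)) := ⟨_, rfl⟩
  rw [← hq_def] at hle
  have hχb : ∀ t, ‖χ (k • (t - x₀))‖ ≤ schwartzSup (0, 0) χ := fun t => by
    simpa using norm_le_schwartzSup 0 χ (k • (t - x₀))
  have hqc : Continuous q := by rw [hq_def]; exact hac.mul hχc
  have hqi : Integrable q := by
    rw [hq_def]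
    exact hai.mul_bdd hχc.aestronglyMeasurable (Filter.Eventually.of_forall hχb)
  have hQc : Continuous (𝓕 q) := VectorFourier.fourierIntegral_continuous Real.continuous_fourierChar
    (innerSL ℝ).continuous₂ hqi
  have hQi := integrable_of_lintegral_weight hs hQc (hle.trans_lt hjt)
  -- Multiplying the dilated bump by `θ` changes nothing, so one copy of `θ` localises `u` and
  -- another carries the finite norm.
  have hqθ : (fun t => q t * θ t) = fun t => χ (k • (t - x₀)) * u t := by
    ext t
    calc q t * θ t = (χ (k • (t - x₀)) * θ t) * θ t * u t := by rw [hq_def]; ring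
      _ = _ := by rw [hmulθ, hmulθ]
  obtain ⟨P, hP⟩ := exists_represents_of_bounded (u := fun t => χ (k • (t - x₀)) * u t)
    (C := schwartzSup (0, 0) χ * (C₀ * stftNorm h p s L).toReal) (hχc.mul hL.1) fun t => by
      rw [norm_mul]
      exact mul_le_mul (hχb t) (hubd t) (norm_nonneg _) ((norm_nonneg _).trans (hχb t))
  refine ⟨P, _, hP, ?_, ?_⟩
  · filter_upwards [Metric.ball_mem_nhds x₀ (inv_pos.2 hk0)] with t ht
    rw [mem_ball_iff_norm] at ht
    rw [hχ1 _ ?_, one_mul]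
    rw [hnorm]
    calc k * ‖t - x₀‖ ≤ k * k⁻¹ := by gcongr
      _ = 1 := mul_inv_cancel₀ hk0.ne'
  · refine (stftNorm_schwartz_mul_le hp hs hΘ (hqθ ▸ hP) hqc hqi hQi).trans_lt
      (lt_of_le_of_lt ?_ hj)
    rw [mul_right_comm]
    exact mul_le_mul_right hle _

end

/-! ### Seminorm properties. -/

section

variable {E : Type*} [NormedAddCommGroup E] [InnerProductSpace ℝ E] [FiniteDimensional ℝ E]
  [MeasurableSpace E] [BorelSpace E]

theorem stftNorm_zero {p : ℝ} (hp : 0 < p) (s : ℝ) (h : 𝓢(E, ℂ)) : stftNorm h p s 0 = 0 := by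
  simp [stftNorm, mixedNorm, hp]

theorem stftNorm_smul {p : ℝ} (hp : 0 < p) (s : ℝ) (h : 𝓢(E, ℂ)) (c : ℂ) (L : 𝓢(E, ℂ) →L[ℂ] ℂ) :
    stftNorm h p s (c • L) = ‖c‖ₑ * stftNorm h p s L := by
  rw [stftNorm, stftNorm, mixedNorm, mixedNorm, ← lintegral_const_mul' _ _ enorm_ne_top]
  refine lintegral_congr fun ξ => ?_
  simp_rw [smul_apply, enorm_smul, ENNReal.mul_rpow_of_nonneg _ _ hp.le]
  rw [lintegral_const_mul' _ _ (ENNReal.rpow_ne_top_of_nonneg hp.le enorm_ne_top),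
    ENNReal.mul_rpow_of_nonneg _ _ (by positivity), ← ENNReal.rpow_mul, mul_one_div_cancel hp.ne',
    ENNReal.rpow_one, mul_left_comm]

theorem mixedNorm_add_le {p : ℝ} (hp : 1 ≤ p) (s : ℝ) {F G : E → E → ℝ≥0∞}
    (hF : Measurable (Function.uncurry F)) (hG : Measurable (Function.uncurry G)) :
    mixedNorm p s (fun x ξ => F x ξ + G x ξ) ≤ mixedNorm p s F + mixedNorm p s G := by
  have hm : Measurable fun ξ : E => weight s ξ * (∫⁻ x, G x ξ ^ p) ^ (1 / p) :=
    (measurable_weight s).mul (measurable_rpow_lintegral_rpow hG p)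
  rw [mixedNorm, mixedNorm, mixedNorm, ← lintegral_add_right _ hm]
  refine lintegral_mono fun ξ => ?_
  rw [← mul_add]
  exact mul_le_mul_right (ENNReal.lintegral_Lp_add_le (hF.of_uncurry_right (y := ξ)).aemeasurable
    (hG.of_uncurry_right (y := ξ)).aemeasurable hp) _

theorem stftNorm_add_le {p : ℝ} (hp : 1 ≤ p) (s : ℝ) (h : 𝓢(E, ℂ)) (L M : 𝓢(E, ℂ) →L[ℂ] ℂ) :
    stftNorm h p s (L + M) ≤ stftNorm h p s L + stftNorm h p s M :=
  (mixedNorm_mono hp fun x ξ => enorm_add_le (L (tfShift x ξ h)) (M (tfShift x ξ h))).trans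
    (mixedNorm_add_le hp s (measurable_enorm_apply_tfShift L h) (measurable_enorm_apply_tfShift M h))

end

/-! ### Comparison of Fourier normalisations. -/

section

variable {n : ℕ}

theorem timeFrequencyShiftConj_smul (φ : 𝓢(EuclideanSpace ℝ (Fin n), ℂ))
    (x ξ : EuclideanSpace ℝ (Fin n)) :
    timeFrequencyShiftConj φ x ((2 * Real.pi) • ξ) = tfShift x ξ (schwartzConj φ) := by
  ext t
  rw [timeFrequencyShiftConj_apply, tfShift_apply, schwartzConj_apply, Real.fourierChar_apply,
    inner_smul_right]
  congr 2
  push_cast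
  ring

/-- Replacing the frequency by `2π` times itself matches the character `exp (-i t·ξ)` with `𝐞`. The
Jacobian is a positive finite constant, so finiteness and smallness of the norms correspond. -/
theorem exists_modulationNorm_eq (φ : 𝓢(EuclideanSpace ℝ (Fin n), ℂ)) {p : ℝ≥0∞} (hp : 1 ≤ p)
    (hp' : p < ∞) (s : ℝ) : ∃ c : ℝ≥0∞, c ≠ 0 ∧ c ≠ ∞ ∧
      ∀ f : 𝓢(EuclideanSpace ℝ (Fin n), ℂ) →L[ℂ] ℂ,
        stftNorm (schwartzConj φ) p.toReal s f =
          c * modulationNorm φ p 1 s (f : 𝓢'(EuclideanSpace ℝ (Fin n), ℂ)) := by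
  have hpi : 0 < 2 * Real.pi := by positivity
  refine ⟨ENNReal.ofReal (((2 * Real.pi) ^ Module.finrank ℝ (EuclideanSpace ℝ (Fin n)))⁻¹), ?_,
    ENNReal.ofReal_ne_top, fun f => ?_⟩
  · rw [Ne, ENNReal.ofReal_eq_zero, not_le]
    positivity
  · change _ = _ * eLpNorm (fun ξ : EuclideanSpace ℝ (Fin n) =>
      ENNReal.ofReal ((1 + ‖ξ‖ ^ 2) ^ (s / 2)) * eLpNorm (fun x : EuclideanSpace ℝ (Fin n) =>
        f (timeFrequencyShiftConj φ x ξ)) p volume) 1 volume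
    rw [eLpNorm_one_eq_lintegral_enorm, ← lintegral_comp_smul_eq _ hpi, stftNorm,
      mixedNorm]
    refine lintegral_congr fun ξ => ?_
    rw [enorm_eq_self, eLpNorm_eq_lintegral_rpow_enorm_toReal (by positivity) hp'.ne]
    simp_rw [timeFrequencyShiftConj_smul]
    rfl

end

/-! ### Closed ideals and approximation. -/

section

variable {n : ℕ} {φ : 𝓢(EuclideanSpace ℝ (Fin n), ℂ)} {p : ℝ≥0∞} {s : ℝ}

theorem schwartzConj_ne_zero (hφ : φ ≠ 0) : schwartzConj φ ≠ 0 := by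
  intro h
  refine hφ (SchwartzMap.ext fun t => ?_)
  have := DFunLike.congr_fun h t
  simpa [schwartzConj_apply] using this

theorem mem_modulationSpace_iff (hp : 1 ≤ p) (hp' : p < ∞)
    (f : 𝓢(EuclideanSpace ℝ (Fin n), ℂ) →L[ℂ] ℂ) :
    (f : 𝓢'(EuclideanSpace ℝ (Fin n), ℂ)) ∈ modulationSpace φ p 1 s ↔
      stftNorm (schwartzConj φ) p.toReal s f < ∞ := by
  obtain ⟨c, hc0, hc, h⟩ := exists_modulationNorm_eq φ hp hp' s
  rw [h]
  constructor
  · exact fun hf => ENNReal.mul_lt_top hc.lt_top hf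
  · intro hf
    change modulationNorm φ p 1 s _ < ∞
    rcases ENNReal.mul_lt_top_iff.1 hf with h1 | h1 | h1
    · exact h1.2
    · exact absurd h1 hc0
    · rw [h1]; exact ENNReal.zero_lt_top

/-- `I(E)` as a linear subspace. -/
noncomputable def vanishingSubmodule (φ : 𝓢(EuclideanSpace ℝ (Fin n), ℂ)) (s : ℝ) (hp : 1 ≤ p)
    (hp' : p < ∞) (E : Set (EuclideanSpace ℝ (Fin n))) :
    Submodule ℂ (𝓢'(EuclideanSpace ℝ (Fin n), ℂ)) where
  carrier := vanishingOn φ p s E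
  add_mem' := by
    rintro f g ⟨hf, u, hu, hu0⟩ ⟨hg, v, hv, hv0⟩
    refine ⟨?_, u + v, Represents.add hu hv, fun x hx => by simp [hu0 x hx, hv0 x hx]⟩
    have hp1 : 1 ≤ p.toReal := ENNReal.toReal_mono hp'.ne hp
    exact (mem_modulationSpace_iff hp hp' _).2 ((stftNorm_add_le hp1 s _ _ _).trans_lt
      (ENNReal.add_lt_top.2 ⟨(mem_modulationSpace_iff hp hp' _).1 hf,
        (mem_modulationSpace_iff hp hp' _).1 hg⟩))
  zero_mem' := by
    have hp1 : 1 ≤ p.toReal := ENNReal.toReal_mono hp'.ne hp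
    refine ⟨(mem_modulationSpace_iff hp hp' 0).2 ?_, 0, ⟨continuous_zero, fun g => ?_⟩,
      fun x _ => rfl⟩
    · rw [stftNorm_zero (zero_lt_one.trans_le hp1)]
      exact ENNReal.zero_lt_top
    · simp
  smul_mem' := by
    rintro c f ⟨hf, u, hu, hu0⟩
    have hp1 : 1 ≤ p.toReal := ENNReal.toReal_mono hp'.ne hp
    refine ⟨(mem_modulationSpace_iff hp hp' _).2 ?_, c • u, Represents.smul c hu,
      fun x hx => by simp [hu0 x hx]⟩
    exact (stftNorm_smul (zero_lt_one.trans_le hp1) s _ c _).trans_lt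
      (ENNReal.mul_lt_top enorm_lt_top ((mem_modulationSpace_iff hp hp' _).1 hf))

theorem sub_eq_add_neg_one_smul (f g : 𝓢'(EuclideanSpace ℝ (Fin n), ℂ)) :
    f - g = f + (-1 : ℂ) • g := by
  ext h
  change f h - g h = f h + (-1) * g h
  ring

theorem sub_mem_modulationSpace (hp : 1 ≤ p) (hp' : p < ∞)
    {f g : 𝓢'(EuclideanSpace ℝ (Fin n), ℂ)} (hf : f ∈ modulationSpace φ p 1 s)
    (hg : g ∈ modulationSpace φ p 1 s) : f - g ∈ modulationSpace φ p 1 s := by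
  have hp1 : 1 ≤ p.toReal := ENNReal.toReal_mono hp'.ne hp
  have h1 := (mem_modulationSpace_iff hp hp' _).1 hf
  have h2 := (mem_modulationSpace_iff hp hp' _).1 hg
  rw [sub_eq_add_neg_one_smul]
  refine (mem_modulationSpace_iff hp hp' _).2 ((stftNorm_add_le hp1 s _ _ _).trans_lt
    (ENNReal.add_lt_top.2 ⟨h1, ?_⟩))
  exact (stftNorm_smul (zero_lt_one.trans_le hp1) s _ (-1) _).trans_lt
    (ENNReal.mul_lt_top enorm_lt_top h2)

theorem isContinuousRep_sub {f g : 𝓢'(EuclideanSpace ℝ (Fin n), ℂ)}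
    {u v : EuclideanSpace ℝ (Fin n) → ℂ} (hf : IsContinuousRep f u) (hg : IsContinuousRep g v) :
    IsContinuousRep (f - g) (u - v) := by
  have h2 : u - v = u + (-1 : ℂ) • v := by rw [neg_one_smul, sub_eq_add_neg]
  rw [sub_eq_add_neg_one_smul, h2]
  exact Represents.add hf (Represents.smul (-1) hg)

theorem exists_isContinuousRep (hφ : φ ≠ 0) (hp : 1 ≤ p) (hp' : p < ∞) (hs : 0 ≤ s) :
    ∃ C : ℝ≥0∞, C ≠ ∞ ∧ ∀ f ∈ modulationSpace φ p 1 s, ∃ u, IsContinuousRep f u ∧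
      ∀ t, ‖u t‖ₑ ≤ C * modulationNorm φ p 1 s f := by
  have hp1 : 1 ≤ p.toReal := ENNReal.toReal_mono hp'.ne hp
  obtain ⟨c, -, hc, h⟩ := exists_modulationNorm_eq φ hp hp' s
  obtain ⟨C, hC, hle⟩ := exists_represents hp1 hs _ (schwartzConj_ne_zero hφ)
  refine ⟨C * c, ENNReal.mul_ne_top hC hc, fun f hf => ?_⟩
  obtain ⟨u, hu, hub⟩ := hle f ((mem_modulationSpace_iff hp hp' _).1 hf)
  refine ⟨u, hu, fun t => ?_⟩
  rw [mul_assoc]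
  exact (hub t).trans_eq (congrArg (C * ·) (h f))

theorem exists_isPointwiseProduct (hφ : φ ≠ 0) (hp : 1 ≤ p) (hp' : p < ∞) (hs : 0 ≤ s)
    {f g : 𝓢'(EuclideanSpace ℝ (Fin n), ℂ)} (hf : f ∈ modulationSpace φ p 1 s)
    (hg : g ∈ modulationSpace φ p 1 s) {u v : EuclideanSpace ℝ (Fin n) → ℂ}
    (hu : IsContinuousRep f u) (hv : IsContinuousRep g v) :
    ∃ h ∈ modulationSpace φ p 1 s, IsContinuousRep h (u * v) := by
  have hp1 : 1 ≤ p.toReal := ENNReal.toReal_mono hp'.ne hp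
  obtain ⟨C, hC, hrep⟩ := exists_isContinuousRep hφ hp hp' hs
  obtain ⟨u', hu', hub⟩ := hrep f hf
  obtain rfl := Represents.unique hu hu'
  obtain ⟨v', hv', hvb⟩ := hrep g hg
  obtain rfl := Represents.unique hv hv'
  have hbd : ∀ t, ‖(u * v) t‖ ≤
      (C * modulationNorm φ p 1 s f * (C * modulationNorm φ p 1 s g)).toReal := fun t => by
    rw [← toReal_enorm]
    refine ENNReal.toReal_mono (ENNReal.mul_ne_top (ENNReal.mul_ne_top hC hf.ne)
      (ENNReal.mul_ne_top hC hg.ne)) ?_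
    rw [Pi.mul_apply, enorm_mul]
    exact mul_le_mul' (hub t) (hvb t)
  obtain ⟨P, hP⟩ := exists_represents_of_bounded (hu.1.mul hv.1) hbd
  exact ⟨P, (mem_modulationSpace_iff hp hp' _).2 (stftNorm_mul_lt_top hp1 hs
    (schwartzConj_ne_zero hφ) hu hv hP ((mem_modulationSpace_iff hp hp' _).1 hf)
    ((mem_modulationSpace_iff hp hp' _).1 hg)), hP⟩

/-- Stability under products is the algebra property; closedness holds because point evaluations are
bounded by the norm. -/
theorem isClosedIdeal_vanishingSubmodule (hφ : φ ≠ 0) (hp : 1 ≤ p) (hp' : p < ∞) (hs : 0 ≤ s)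
    (E : Set (EuclideanSpace ℝ (Fin n))) :
    IsClosedIdeal φ p s (vanishingSubmodule φ s hp hp' E) where
  subset f hf := hf.1
  mul_mem := by
    rintro f hf g ⟨hg, v, hv, hv0⟩
    obtain ⟨C, -, hrep⟩ := exists_isContinuousRep hφ hp hp' hs
    obtain ⟨u, hu, -⟩ := hrep f hf
    obtain ⟨P, hP, hPr⟩ := exists_isPointwiseProduct hφ hp hp' hs hf hg hu hv
    exact ⟨P, ⟨hP, _, hPr, fun x hx => by simp [hv0 x hx]⟩, u, v, hu, hv, hPr⟩
  closed := by
    intro f hf happ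
    obtain ⟨C, hC, hrep⟩ := exists_isContinuousRep hφ hp hp' hs
    obtain ⟨u, hu, -⟩ := hrep f hf
    refine ⟨hf, u, hu, fun x hx => ?_⟩
    have hle : ∀ ε : ℝ≥0∞, 0 < ε → ‖u x‖ₑ ≤ C * ε := fun ε hε => by
      obtain ⟨g, ⟨hg, v, hv, hv0⟩, hgε⟩ := happ ε hε
      obtain ⟨w, hw, hwb⟩ := hrep (f - g) (sub_mem_modulationSpace hp hp' hf hg)
      have h1 : w = u - v := Represents.unique hw (isContinuousRep_sub hu hv)
      have h2 := hwb x
      rw [h1, Pi.sub_apply, hv0 x hx, sub_zero] at h2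
      exact h2.trans (mul_le_mul_right hgε.le _)
    have hlim : Filter.Tendsto (fun ε : ℝ≥0∞ => C * ε) (𝓝[>] 0) (𝓝 (C * 0)) :=
      ENNReal.Tendsto.const_mul (Filter.tendsto_id.mono_left nhdsWithin_le_nhds) (Or.inr hC)
    rw [mul_zero] at hlim
    have h3 := ge_of_tendsto hlim (by filter_upwards [self_mem_nhdsWithin] with ε hε using hle ε hε)
    exact enorm_eq_zero.1 (le_antisymm h3 zero_le)

/-- A function vanishing at `x₀` is approximated by functions vanishing near `x₀`. -/
theorem exists_mem_vanishingNear_modulationNorm_sub_lt (hφ : φ ≠ 0) (hp : 1 ≤ p) (hp' : p < ∞)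
    (hs : 0 ≤ s) (hs1 : s < 1) {x₀ : EuclideanSpace ℝ (Fin n)}
    {f : 𝓢'(EuclideanSpace ℝ (Fin n), ℂ)} (hf : f ∈ vanishingOn φ p s {x₀}) {ε : ℝ≥0∞}
    (hε : 0 < ε) : ∃ g ∈ vanishingNear φ p s {x₀}, modulationNorm φ p 1 s (f - g) < ε := by
  obtain ⟨hfX, u, hu, hu0⟩ := hf
  have hp1 : 1 ≤ p.toReal := ENNReal.toReal_mono hp'.ne hp
  obtain ⟨c, hc0, hc, h⟩ := exists_modulationNorm_eq φ hp hp' s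
  -- `ε` may be infinite; the minimum with 1 ensures that the approximant itself has finite norm.
  have hδ : 0 < c * min ε 1 := ENNReal.mul_pos hc0 (lt_min hε one_pos).ne'
  obtain ⟨P, v, hP, hvu, hPn⟩ := exists_represents_eventuallyEq_stftNorm_lt hp1 hs hs1
    (schwartzConj_ne_zero hφ) hu ((mem_modulationSpace_iff hp hp' _).1 hfX) (hu0 x₀ rfl) hδ
  rw [h, ENNReal.mul_lt_mul_iff_right hc0 hc] at hPn
  obtain ⟨F, hF⟩ : ∃ F : 𝓢'(EuclideanSpace ℝ (Fin n), ℂ), F = P := ⟨P, rfl⟩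
  have hFX : F ∈ modulationSpace φ p 1 s := by
    rw [hF]
    exact hPn.trans_le ((min_le_right _ _).trans le_top)
  have hFv : IsContinuousRep F v := by rw [hF]; exact hP
  refine ⟨f - F, ⟨sub_mem_modulationSpace hp hp' hfX hFX, u - v, isContinuousRep_sub hu hFv, ?_⟩, ?_⟩
  · rw [nhdsSet_singleton]
    filter_upwards [hvu] with t ht
    simp [ht]
  · rw [sub_sub_cancel, hF]
    exact hPn.trans_le (min_le_left _ _)

end
end ModulationSpace

theorem mainTheorem5 (n : ℕ) (φ : 𝓢(EuclideanSpace ℝ (Fin n), ℂ)) (hφ : φ ≠ 0)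
    (p : ℝ≥0∞) (hp : 1 ≤ p) (hp' : p < ∞) (s : ℝ) (hs : 0 ≤ s) (hs' : s < 1)
    (x₀ : EuclideanSpace ℝ (Fin n)) :
    ModulationSpace.IsSpectralSynthesisSet φ p s {x₀} := by
  refine ⟨isClosed_singleton, Set.Subset.antisymm (fun f hf => ⟨hf.1, fun I hI hJ => ?_⟩)
    fun f hf => hf.2 _ (ModulationSpace.isClosedIdeal_vanishingSubmodule hφ hp hp' hs {x₀}) ?_⟩
  -- Closedness of the ideal is all that is used here: `vanishingNear` is already dense in the
  -- functions vanishing at `x₀`.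
  · refine hI.closed f hf.1 fun ε hε => ?_
    obtain ⟨g, hg, hgε⟩ := ModulationSpace.exists_mem_vanishingNear_modulationNorm_sub_lt hφ hp hp'
      hs hs' hf hε
    exact ⟨g, hJ hg, hgε⟩
  · rintro g ⟨hg, u, hu, hu0⟩
    exact ⟨hg, u, hu, fun x hx => hu0.self_of_nhdsSet x hx⟩
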